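/- Let $k\ge 1$, let $Q$ be a smooth (Hausdorff, second countable) $n$-dimensional manifold, and let $T^rQ$ denote the $r$-th order tangent bundle, i.e. the manifold of $r$-jets $j^r_0\phi$ at $0$ of curves in $Q$, with natural coordinates $(q_0,\dots,q_r)$, projections $\rho^r_s\colon T^rQ\to T^sQ$ and $\beta^r\colon T^rQ\to Q$, and $j^r\phi$ the canonical lifting of a curve $\phi$ to $T^rQ$ ($T^0Q=Q$). Let $\mathcal L\in C^\infty(T^kQ)$ be a $k$-th order Lagrangian, with momenta $\hat p^{\,r-1}_A=\sum_{i=0}^{k-r}(-1)^i d_T^i\big(\partial\mathcal L/\partial q^A_{r+i}\big)$, $1\le r\le k$ (where $d_T$ is the total time derivative), energy $E_{\mathcal L}=\sum_{r=1}^k q_r^A\hat p^{\,r-1}_A-\mathcal L\in C^\infty(T^{2k-1}Q)$, and Legendre–Ostrogradsky map $\mathcal{FL}\colon T^{2k-1}Q\to T^*(T^{k-1}Q)$, $\mathcal{FL}(y)=\sum_{r=1}^k\hat p^{\,r-1}_A(y)\,dq^A_{r-1}\big|_{\rho^{2k-1}_{k-1}(y)}$. Assume that $\mathcal L$ is hyperregular,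 i.e. that $\mathcal{FL}$ is a diffeomorphism. Let $h\in C^\infty(T^*(T^{k-1}Q))$ be the associated Hamiltonian, $h\circ\mathcal{FL}=E_{\mathcal L}$, let $\omega_{k-1}=-d\theta_{k-1}$ be the canonical symplectic form of $T^*(T^{k-1}Q)$ ($\theta_{k-1}$ the Liouville form), and let $X_h$ be the vector field on $T^*(T^{k-1}Q)$ with $i(X_h)\,\omega_{k-1}=dh$. For a smooth $1$-form $\alpha$ on $T^{k-1}Q$, regarded as a section of $\pi\colon T^*(T^{k-1}Q)\to T^{k-1}Q$, put $X=T\pi\circ X_h\circ\alpha$, a vector field on $T^{k-1}Q$. Proposition. Suppose that $\alpha$ is a solution to the $k$-th order Hamiltonian Hamilton–Jacobi problem, i.e. $d\alpha=0$ and, for every integral curve $\gamma$ of $X$ (defined on an open interval), $\alpha\circ\gamma$ is an integral curve of $X_h$. Then $X$ is a semispray of type $1$ on $T^{k-1}Q$: every integral curve $\psi\colon J\to T^{k-1}Q$ of $X$, $J\subseteq\mathbb R$ an open interval, is holonomic, that is, $\phi=\beta^{k-1}\circ\psi$ is a smooth curve in $Q$ and $\psi=j^{k-1}\phi$ on $J$.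 -/

import Mathlib

open scoped Manifold ContDiff Topology

noncomputable section

set_option linter.unusedSectionVars false

namespace HigherOrder

open Set

theorem iteratedDeriv_comp_congr {E F : Type*} [NormedAddCommGroup E] [NormedSpace ℝ E]
    [NormedAddCommGroup F] [NormedSpace ℝ F] {g : E → F} {c d : ℝ → E} {r : ℕ}
    (hg : ContDiffAt ℝ ∞ g (c 0)) (hc : ContDiffAt ℝ ∞ c 0) (hd : ContDiffAt ℝ ∞ d 0)
    (h : ∀ i ≤ r, iteratedDeriv i c 0 = iteratedDeriv i d 0) :
    ∀ i ≤ r, iteratedDeriv i (g ∘ c) 0 = iteratedDeriv i (g ∘ d) 0 := by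
  intro i hi
  have h0 : c 0 = d 0 := by simpa using h 0 (Nat.zero_le r)
  have hF : ∀ j ≤ r, iteratedFDeriv ℝ j c 0 = iteratedFDeriv ℝ j d 0 := by
    intro j hj
    rw [iteratedFDeriv_eq_equiv_comp, iteratedFDeriv_eq_equiv_comp]
    simp [h j hj]
  have hi' : ((i : ℕ∞) : WithTop ℕ∞) ≤ ((⊤ : ℕ∞) : WithTop ℕ∞) := by exact_mod_cast le_top
  rw [iteratedDeriv, iteratedDeriv, iteratedFDeriv_comp hg hc hi',
    iteratedFDeriv_comp (h0 ▸ hg) hd hi', ← h0]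
  congr 1
  simp only [FormalMultilinearSeries.taylorComp]
  refine Finset.sum_congr rfl fun p _ => ?_
  unfold FormalMultilinearSeries.compAlongOrderedFinpartition
  congr 1
  funext a
  exact hF _ ((p.partSize_le a).trans hi)

/-- The polynomial curve `t ↦ ∑ j, (t ^ j / j!) • z j`, whose derivatives at `0` are the `z j`. -/
def polyCurve {E : Type*} [NormedAddCommGroup E] [NormedSpace ℝ E] {r : ℕ}
    (z : Fin (r + 1) → E) (t : ℝ) : E :=
  ∑ j : Fin (r + 1), (t ^ (j : ℕ) / (Nat.factorial j : ℝ)) • z j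

theorem contDiff_polyCurve_uncurry {E : Type*} [NormedAddCommGroup E] [NormedSpace ℝ E] {r : ℕ} :
    ContDiff ℝ ∞ (fun p : (Fin (r + 1) → E) × ℝ => polyCurve p.1 p.2) := by
  unfold polyCurve
  fun_prop

theorem contDiff_polyCurve {E : Type*} [NormedAddCommGroup E] [NormedSpace ℝ E] {r : ℕ}
    (z : Fin (r + 1) → E) : ContDiff ℝ ∞ (polyCurve z) := by
  unfold polyCurve
  fun_prop

theorem iteratedDeriv_polyCurve {E : Type*} [NormedAddCommGroup E] [NormedSpace ℝ E] {r : ℕ}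
    (z : Fin (r + 1) → E) (i : Fin (r + 1)) : iteratedDeriv i (polyCurve z) 0 = z i := by
  have h : polyCurve z = fun t => ∑ j : Fin (r + 1), (t ^ (j : ℕ)) • (((Nat.factorial j : ℝ))⁻¹ • z j) := by
    funext t
    simp [polyCurve, smul_smul, div_eq_mul_inv]
  rw [h, iteratedDeriv_fun_sum (fun j _ => by fun_prop)]
  rw [Finset.sum_eq_single i]
  · rw [iteratedDeriv_smul_const (by fun_prop)]
    rw [iteratedDeriv_fun_pow_zero]
    simp [smul_smul, Nat.factorial_ne_zero]
  · intro j _ hj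
    rw [iteratedDeriv_smul_const (by fun_prop), iteratedDeriv_fun_pow_zero, if_neg, Nat.cast_zero,
      zero_smul]
    exact fun h => hj (Fin.ext h.symm)
  · simp

theorem polyCurve_zero {E : Type*} [NormedAddCommGroup E] [NormedSpace ℝ E] {r : ℕ}
    (z : Fin (r + 1) → E) : polyCurve z 0 = z 0 := by
  simpa using iteratedDeriv_polyCurve z 0

theorem contDiffOn_iteratedDeriv_param {P F : Type*} [NormedAddCommGroup P] [NormedSpace ℝ P]
    [NormedAddCommGroup F] [NormedSpace ℝ F] {G : P × ℝ → F} {U : Set (P × ℝ)} (hU : IsOpen U)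
    (hG : ContDiffOn ℝ ∞ G U) (i : ℕ) :
    ContDiffOn ℝ ∞ (fun p : P × ℝ => iteratedDeriv i (fun t => G (p.1, t)) p.2) U := by
  induction i with
  | zero => simpa using hG
  | succ i ih =>
    have h1 := (ih.fderiv_of_isOpen hU (m := ∞) (by simp)).clm_apply
      (contDiffOn_const (c := ((0 : P), (1 : ℝ))))
    refine h1.congr fun p hp => ?_
    rw [iteratedDeriv_succ]
    have hd := ((ih.contDiffAt (hU.mem_nhds hp)).differentiableAt (by simp)).hasFDerivAt
    have hl : HasDerivAt (fun t : ℝ => (p.1, t)) ((0 : P), (1 : ℝ)) p.2 :=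
      (hasDerivAt_const _ _).prodMk (hasDerivAt_id _)
    exact (HasFDerivAt.comp_hasDerivAt p.2 (f := fun t : ℝ => (p.1, t)) hd hl).deriv


section Jets

variable (E : Type*) [NormedAddCommGroup E] [NormedSpace ℝ E] (r : ℕ)
  (Q : Type*) [TopologicalSpace Q] [ChartedSpace E Q]

/-- Curves in `Q` that are smooth at `0`. -/
def CurveAtZero : Type _ := {φ : ℝ → Q // ContMDiffAt 𝓘(ℝ, ℝ) 𝓘(ℝ, E) ∞ φ 0}

variable {E Q}

/-- The natural coordinates `(q₀, …, q_r)` at `t = 0` of a curve `φ` in a chart `e`: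
`q_i` is the `i`-th derivative of `e ∘ φ` at `0`. -/
def curveCoord (e : OpenPartialHomeomorph Q E) (φ : ℝ → Q) : Fin (r + 1) → E :=
  fun i => iteratedDeriv i (e ∘ φ) 0

variable (E Q)

/-- `r`-jet equivalence at `0`. -/
def jetSetoid : Setoid (CurveAtZero E Q) where
  r φ ψ := φ.1 0 = ψ.1 0 ∧
    curveCoord r (chartAt E (φ.1 0)) φ.1 = curveCoord r (chartAt E (φ.1 0)) ψ.1
  iseqv :=
    { refl := fun _ => ⟨rfl, rfl⟩
      symm := fun h => ⟨h.1.symm, by rw [← h.1]; exact h.2.symm⟩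
      trans := fun h h' => ⟨h.1.trans h'.1, h.2.trans (by rw [h.1]; exact h'.2)⟩ }

/-- The `r`-th order tangent bundle `T^r Q` of a manifold `Q` modelled on `E`: the set of `r`-jets
at `0` of curves in `Q`. -/
def HTangent : Type _ := Quotient (jetSetoid E r Q)

variable {E Q}

/-- The `r`-jet at `t = 0` of a curve that is smooth at `0`. -/
def jetZero (φ : ℝ → Q) (h : ContMDiffAt 𝓘(ℝ, ℝ) 𝓘(ℝ, E) ∞ φ 0) : HTangent E r Q :=
  Quotient.mk (jetSetoid E r Q) ⟨φ, h⟩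

theorem contMDiffAt_shift {φ : ℝ → Q} {t : ℝ} (h : ContMDiffAt 𝓘(ℝ, ℝ) 𝓘(ℝ, E) ∞ φ t) :
    ContMDiffAt 𝓘(ℝ, ℝ) 𝓘(ℝ, E) ∞ (fun s => φ (t + s)) 0 := by
  have h1 : ContMDiffAt 𝓘(ℝ, ℝ) 𝓘(ℝ, ℝ) ∞ (fun s : ℝ => t + s) 0 :=
    ContDiffAt.contMDiffAt (by fun_prop)
  exact ContMDiffAt.comp (0 : ℝ) (by simpa using h) h1

/-- The canonical lifting `j^r φ` of a curve `φ`, at a time `t` at which `φ` is smooth: the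
`r`-jet at `0` of `s ↦ φ (t + s)`. -/
def jetLift (φ : ℝ → Q) (t : ℝ) (h : ContMDiffAt 𝓘(ℝ, ℝ) 𝓘(ℝ, E) ∞ φ t) : HTangent E r Q :=
  jetZero r (fun s => φ (t + s)) (contMDiffAt_shift h)

variable {r}

/-- The projection `β^r : T^r Q → Q`. -/
def HTangent.base (y : HTangent E r Q) : Q :=
  Quotient.lift (s := jetSetoid E r Q) (fun φ => φ.1 0) (fun _ _ h => h.1) y

/-- The projection `ρ^r_s : T^r Q → T^s Q`, for `s ≤ r`. -/
def HTangent.proj {s : ℕ} (hs : s ≤ r) (y : HTangent E r Q) : HTangent E s Q :=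
  Quotient.map' (s₁ := jetSetoid E r Q) (s₂ := jetSetoid E s Q) id
    (fun _ _ h => ⟨h.1, funext fun i =>
      congrFun h.2 ⟨i, lt_of_lt_of_le i.2 (Nat.succ_le_succ hs)⟩⟩) y

@[simp] theorem base_jetZero (φ : ℝ → Q) (h : ContMDiffAt 𝓘(ℝ, ℝ) 𝓘(ℝ, E) ∞ φ 0) :
    (jetZero r φ h).base = φ 0 := rfl

@[simp] theorem proj_jetZero {s : ℕ} (hs : s ≤ r) (φ : ℝ → Q)
    (h : ContMDiffAt 𝓘(ℝ, ℝ) 𝓘(ℝ, E) ∞ φ 0) :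
    (jetZero r φ h).proj hs = jetZero s φ h := rfl

@[simp] theorem base_proj {s : ℕ} (hs : s ≤ r) (y : HTangent E r Q) :
    (y.proj hs).base = y.base := by
  induction y using Quotient.inductionOn with
  | h φ => rfl

variable [IsManifold 𝓘(ℝ, E) ∞ Q]

theorem contDiffAt_chart_comp {e : OpenPartialHomeomorph Q E} (he : e ∈ atlas E Q) {φ : ℝ → Q}
    {t : ℝ} (h : ContMDiffAt 𝓘(ℝ, ℝ) 𝓘(ℝ, E) ∞ φ t) (h0 : φ t ∈ e.source) :
    ContDiffAt ℝ ∞ (e ∘ φ) t :=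
  ((contMDiffAt_of_mem_maximalAtlas (IsManifold.subset_maximalAtlas he) h0).comp t h).contDiffAt

theorem contMDiffAt_symm_comp {e : OpenPartialHomeomorph Q E} (he : e ∈ atlas E Q) {c : ℝ → E}
    {t : ℝ} (h : ContDiffAt ℝ ∞ c t) (h0 : c t ∈ e.target) :
    ContMDiffAt 𝓘(ℝ, ℝ) 𝓘(ℝ, E) ∞ (e.symm ∘ c) t :=
  (contMDiffAt_symm_of_mem_maximalAtlas (IsManifold.subset_maximalAtlas he) h0).comp t
    h.contMDiffAt

theorem contDiffOn_transition {e e' : OpenPartialHomeomorph Q E} (he : e ∈ atlas E Q)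
    (he' : e' ∈ atlas E Q) : ContDiffOn ℝ ∞ (e' ∘ e.symm) (e.target ∩ e.symm ⁻¹' e'.source) := by
  have h1 : ContMDiffOn 𝓘(ℝ, E) 𝓘(ℝ, E) ∞ e.symm (e.target ∩ e.symm ⁻¹' e'.source) :=
    (contMDiffOn_symm_of_mem_maximalAtlas (IsManifold.subset_maximalAtlas he)).mono
      inter_subset_left
  exact ((contMDiffOn_of_mem_maximalAtlas (IsManifold.subset_maximalAtlas he')).comp h1
    (fun z hz => hz.2)).contDiffOn

/-- Coincidence of `r`-jets in one chart implies coincidence in any other chart. -/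
theorem curveCoord_congr {e e' : OpenPartialHomeomorph Q E} (he : e ∈ atlas E Q)
    (he' : e' ∈ atlas E Q) {φ ψ : ℝ → Q} (hφ : ContMDiffAt 𝓘(ℝ, ℝ) 𝓘(ℝ, E) ∞ φ 0)
    (hψ : ContMDiffAt 𝓘(ℝ, ℝ) 𝓘(ℝ, E) ∞ ψ 0) (h0 : φ 0 = ψ 0) (hs : φ 0 ∈ e.source)
    (hs' : φ 0 ∈ e'.source) (h : curveCoord r e φ = curveCoord r e ψ) :
    curveCoord r e' φ = curveCoord r e' ψ := by
  have key : ∀ χ : ℝ → Q, ContMDiffAt 𝓘(ℝ, ℝ) 𝓘(ℝ, E) ∞ χ 0 → χ 0 ∈ e.source →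
      (e' ∘ χ) =ᶠ[𝓝 0] ((e' ∘ e.symm) ∘ (e ∘ χ)) := by
    intro χ hχ hχ0
    filter_upwards [hχ.continuousAt.preimage_mem_nhds (e.open_source.mem_nhds hχ0)] with t ht
    simp [e.left_inv ht]
  have hg : ContDiffAt ℝ ∞ (e' ∘ e.symm) ((e ∘ φ) 0) := by
    refine (contDiffOn_transition he he').contDiffAt (IsOpen.mem_nhds ?_ ?_)
    · exact e.isOpen_inter_preimage_symm e'.open_source
    · exact ⟨e.map_source hs, by simpa [e.left_inv hs] using hs'⟩
  funext i
  simp only [curveCoord]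
  rw [(key φ hφ hs).iteratedDeriv_eq, (key ψ hψ (h0 ▸ hs)).iteratedDeriv_eq]
  refine iteratedDeriv_comp_congr hg (contDiffAt_chart_comp he hφ hs)
    (contDiffAt_chart_comp he hψ (h0 ▸ hs)) (r := r) (fun j hj => ?_) i (Nat.lt_succ_iff.mp i.2)
  exact congrFun h ⟨j, Nat.lt_succ_of_le hj⟩

variable (r)

/-- The point of `T^r Q` with natural coordinates `z` in the chart `e`: the jet of the curve which
reads in `e` as the polynomial with derivatives `z` (a constant curve when `z 0` is outside the
range of `e`). -/
def natPoint (e : OpenPartialHomeomorph Q E) (he : e ∈ atlas E Q) (z : Fin (r + 1) → E) :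
    HTangent E r Q := by
  classical
  exact if h : z 0 ∈ e.target then
    jetZero r (e.symm ∘ polyCurve z)
      (contMDiffAt_symm_comp he (contDiff_polyCurve z).contDiffAt (by rwa [polyCurve_zero]))
  else jetZero r (fun _ => e.symm (z 0)) contMDiffAt_const

theorem curveCoord_symm_comp {e : OpenPartialHomeomorph Q E} {c : ℝ → E}
    (hc : ContinuousAt c 0) (h0 : c 0 ∈ e.target) (i : Fin (r + 1)) :
    curveCoord r e (e.symm ∘ c) i = iteratedDeriv i c 0 := by
  have : (e ∘ e.symm ∘ c) =ᶠ[𝓝 0] c := by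
    filter_upwards [hc.preimage_mem_nhds (e.open_target.mem_nhds h0)] with t ht
    exact e.right_inv ht
  exact this.iteratedDeriv_eq _

theorem curveCoord_polyCurve {e : OpenPartialHomeomorph Q E} {z : Fin (r + 1) → E}
    (h0 : z 0 ∈ e.target) : curveCoord r e (e.symm ∘ polyCurve z) = z := by
  funext i
  rw [curveCoord_symm_comp r (contDiff_polyCurve z).continuous.continuousAt
    (by rwa [polyCurve_zero]), iteratedDeriv_polyCurve]

/-- The natural coordinates of a jet (read on a representing curve). -/
def natCoord (e : OpenPartialHomeomorph Q E) (y : HTangent E r Q) : Fin (r + 1) → E :=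
  curveCoord r e (Quotient.out y).1

theorem natCoord_jetZero {e : OpenPartialHomeomorph Q E} (he : e ∈ atlas E Q) (φ : ℝ → Q)
    (h : ContMDiffAt 𝓘(ℝ, ℝ) 𝓘(ℝ, E) ∞ φ 0) (h0 : φ 0 ∈ e.source) :
    natCoord r e (jetZero r φ h) = curveCoord r e φ := by
  have hrel : (jetSetoid E r Q).r (Quotient.out (jetZero r φ h)) ⟨φ, h⟩ :=
    Quotient.exact (Quotient.out_eq _)
  have h1 : (Quotient.out (jetZero r φ h)).1 0 = φ 0 := hrel.1
  exact curveCoord_congr (chart_mem_atlas E _) he (Quotient.out (jetZero r φ h)).2 h hrel.1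
    (mem_chart_source E _) (h1 ▸ h0) hrel.2

/-- The natural chart `(q₀, …, q_r)` of `T^r Q` induced by a chart `e` of `Q`. -/
def natChart (e : OpenPartialHomeomorph Q E) (he : e ∈ atlas E Q) :
    PartialEquiv (HTangent E r Q) (Fin (r + 1) → E) where
  toFun := natCoord r e
  invFun := natPoint r e he
  source := {y | y.base ∈ e.source}
  target := {z | z 0 ∈ e.target}
  map_source' := by
    intro y
    induction y using Quotient.inductionOn with
    | h φ =>
      intro (hy : φ.1 0 ∈ e.source)
      change natCoord r e (jetZero r φ.1 φ.2) 0 ∈ e.target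
      rw [natCoord_jetZero r he _ _ hy]
      simpa [curveCoord] using e.map_source hy
  map_target' := by
    intro z (hz : z 0 ∈ e.target)
    simp only [natPoint, dif_pos hz, mem_ofPred_eq, base_jetZero, Function.comp_apply,
      polyCurve_zero]
    exact e.map_target hz
  left_inv' := by
    intro y
    induction y using Quotient.inductionOn with
    | h φ =>
      intro (hy : φ.1 0 ∈ e.source)
      change natPoint r e he (natCoord r e (jetZero r φ.1 φ.2)) = jetZero r φ.1 φ.2
      rw [natCoord_jetZero r he _ _ hy]
      have hz : curveCoord r e φ.1 0 = e (φ.1 0) := by simp [curveCoord]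
      have hz' : curveCoord r e φ.1 0 ∈ e.target := hz ▸ e.map_source hy
      rw [natPoint, dif_pos hz']
      have hb : (e.symm ∘ polyCurve (curveCoord r e φ.1)) 0 = φ.1 0 := by
        simp [polyCurve_zero, hz, e.left_inv hy]
      refine Quotient.sound ⟨hb, ?_⟩
      refine curveCoord_congr he (chart_mem_atlas E _)
        (contMDiffAt_symm_comp he (contDiff_polyCurve _).contDiffAt (by rwa [polyCurve_zero]))
        φ.2 hb (mem_of_eq_of_mem hb hy) (mem_chart_source E _) ?_
      exact curveCoord_polyCurve r hz'
  right_inv' := by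
    intro z (hz : z 0 ∈ e.target)
    rw [natPoint, dif_pos hz, natCoord_jetZero r he, curveCoord_polyCurve r hz]
    simp only [Function.comp_apply, polyCurve_zero]
    exact e.map_target hz

theorem isOpen_natChart_trans_source (e e' : OpenPartialHomeomorph Q E) (he : e ∈ atlas E Q)
    (he' : e' ∈ atlas E Q) :
    IsOpen ((natChart r e he).symm.trans (natChart r e' he')).source := by
  have : ((natChart r e he).symm.trans (natChart r e' he')).source =
      (fun z : Fin (r + 1) → E => z 0) ⁻¹' (e.target ∩ e.symm ⁻¹' e'.source) := by
    ext z
    constructor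
    · rintro ⟨h1 : z 0 ∈ e.target, h2 : (natPoint r e he z).base ∈ e'.source⟩
      rw [natPoint, dif_pos h1] at h2
      exact ⟨h1, by simpa [polyCurve_zero] using h2⟩
    · rintro ⟨h1 : z 0 ∈ e.target, h2 : e.symm (z 0) ∈ e'.source⟩
      refine ⟨h1, ?_⟩
      change (natPoint r e he z).base ∈ e'.source
      rw [natPoint, dif_pos h1]
      simpa [polyCurve_zero] using h2
  rw [this]
  exact (e.isOpen_inter_preimage_symm e'.open_source).preimage (continuous_apply 0)

theorem contDiffOn_natChart_trans (e e' : OpenPartialHomeomorph Q E) (he : e ∈ atlas E Q)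
    (he' : e' ∈ atlas E Q) :
    ContDiffOn ℝ ∞ ((natChart r e he).symm.trans (natChart r e' he'))
      ((natChart r e he).symm.trans (natChart r e' he')).source := by
  set V : Set E := e.target ∩ e.symm ⁻¹' e'.source with hV
  have hVo : IsOpen V := e.isOpen_inter_preimage_symm e'.open_source
  set U : Set ((Fin (r + 1) → E) × ℝ) := (fun p => polyCurve p.1 p.2) ⁻¹' V with hU
  have hUo : IsOpen U := hVo.preimage contDiff_polyCurve_uncurry.continuous
  have hG : ContDiffOn ℝ ∞
      (fun p : (Fin (r + 1) → E) × ℝ => (e' ∘ e.symm) (polyCurve p.1 p.2)) U :=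
    (contDiffOn_transition he he').comp contDiff_polyCurve_uncurry.contDiffOn (fun p hp => hp)
  rw [contDiffOn_pi]
  intro i
  have h1 := contDiffOn_iteratedDeriv_param hUo hG i
  have h2 : ContDiffOn ℝ ∞ (fun z : Fin (r + 1) → E =>
      iteratedDeriv i (fun t => (e' ∘ e.symm) (polyCurve z t)) 0) {z | z 0 ∈ V} :=
    h1.comp (f := fun z : Fin (r + 1) → E => (z, (0 : ℝ)))
      (contDiff_id.prodMk contDiff_const).contDiffOn
      (fun z (hz : z 0 ∈ V) => by simpa [hU, polyCurve_zero] using hz)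
  have hsrc : ∀ z ∈ ((natChart r e he).symm.trans (natChart r e' he')).source, z 0 ∈ V := by
    rintro z ⟨h1 : z 0 ∈ e.target, h2 : (natPoint r e he z).base ∈ e'.source⟩
    rw [natPoint, dif_pos h1] at h2
    exact ⟨h1, by simpa [polyCurve_zero] using h2⟩
  refine (h2.mono hsrc).congr fun z hz => ?_
  have hz' := hsrc z hz
  change natCoord r e' (natPoint r e he z) i = _
  rw [natPoint, dif_pos hz'.1, natCoord_jetZero r he']
  · rfl
  · simpa [polyCurve_zero] using hz'.2

variable (E Q)

/-- The natural charts form an atlas of `T^r Q`. -/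
def htangentCore : ChartedSpaceCore (Fin (r + 1) → E) (HTangent E r Q) where
  atlas := {c | ∃ (e : OpenPartialHomeomorph Q E) (he : e ∈ atlas E Q), c = natChart r e he}
  chartAt y := natChart r (chartAt E y.base) (chart_mem_atlas E y.base)
  mem_chart_source y := mem_chart_source E y.base
  chart_mem_atlas y := ⟨_, _, rfl⟩
  open_source := by
    rintro _ _ ⟨e, he, rfl⟩ ⟨e', he', rfl⟩
    exact isOpen_natChart_trans_source r e e' he he'
  continuousOn_toFun := by
    rintro _ _ ⟨e, he, rfl⟩ ⟨e', he', rfl⟩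
    exact (contDiffOn_natChart_trans r e e' he he').continuousOn

instance : TopologicalSpace (HTangent E r Q) := (htangentCore E r Q).toTopologicalSpace

instance : ChartedSpace (Fin (r + 1) → E) (HTangent E r Q) := (htangentCore E r Q).toChartedSpace

instance : IsManifold 𝓘(ℝ, Fin (r + 1) → E) ∞ (HTangent E r Q) := by
  refine isManifold_of_contDiffOn _ _ _ ?_
  intro c c' hc hc'
  obtain ⟨_, ⟨e, he, rfl⟩, rfl⟩ := mem_iUnion₂.mp hc
  obtain ⟨_, ⟨e', he', rfl⟩, rfl⟩ := mem_iUnion₂.mp hc'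
  have h := contDiffOn_natChart_trans r e e' he he'
  simp only [modelWithCornersSelf_coe, modelWithCornersSelf_coe_symm, Function.comp_id,
    Function.id_comp, preimage_id_eq, id_eq, range_id, inter_univ]
  exact h

variable {E Q r}

theorem natCoord_proj {s : ℕ} (hs : s ≤ r) {e : OpenPartialHomeomorph Q E} (he : e ∈ atlas E Q)
    (y : HTangent E r Q) (hy : y.base ∈ e.source) :
    natCoord s e (y.proj hs) =
      fun i => natCoord r e y (Fin.castLE (Nat.succ_le_succ hs) i) := by
  induction y using Quotient.inductionOn with
  | h φ =>
    change natCoord s e (jetZero s φ.1 φ.2) = fun i => natCoord r e (jetZero r φ.1 φ.2) _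
    rw [natCoord_jetZero s he _ _ hy, natCoord_jetZero r he _ _ hy]
    rfl

theorem mdifferentiableAt_proj {s : ℕ} (hs : s ≤ r) (y : HTangent E r Q) :
    MDifferentiableAt 𝓘(ℝ, Fin (r + 1) → E) 𝓘(ℝ, Fin (s + 1) → E)
      (HTangent.proj (E := E) (Q := Q) hs) y := by
  set e := chartAt E y.base with he
  have hye : y.base ∈ e.source := mem_chart_source E _
  set c := chartAt (Fin (r + 1) → E) y with hc
  set c' := chartAt (Fin (s + 1) → E) (y.proj hs) with hc'
  have hsrc : ∀ y' : HTangent E r Q, y' ∈ c.source ↔ y'.base ∈ e.source := fun _ => Iff.rfl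
  have hee : chartAt E (y.proj hs).base = e := by rw [base_proj]
  have hsrc' : ∀ y' : HTangent E s Q, y' ∈ c'.source ↔ y'.base ∈ e.source := by
    intro y'
    change y'.base ∈ (chartAt E (y.proj hs).base).source ↔ _
    rw [hee]
  have hcoe' : ∀ y' : HTangent E s Q, c' y' = natCoord s e y' := by
    intro y'
    change natCoord s (chartAt E (y.proj hs).base) y' = _
    rw [hee]
  set R : (Fin (r + 1) → E) → (Fin (s + 1) → E) :=
    fun z i => z (Fin.castLE (Nat.succ_le_succ hs) i) with hR
  have hRd : Differentiable ℝ R := by rw [hR]; fun_prop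
  have hkey : ∀ y' ∈ c.source, R (c y') = c' (y'.proj hs) := by
    intro y' hy'
    rw [hcoe', natCoord_proj hs (chart_mem_atlas E _) y' ((hsrc y').1 hy')]
    rfl
  have hev : HTangent.proj (E := E) (Q := Q) hs =ᶠ[𝓝 y] (c'.symm ∘ R ∘ c) := by
    filter_upwards [c.open_source.mem_nhds (mem_chart_source _ y)] with y' hy'
    simp only [Function.comp_apply]
    rw [hkey y' hy', c'.left_inv]
    rw [hsrc', base_proj]
    exact (hsrc y').1 hy'
  have h1 : MDifferentiableAt 𝓘(ℝ, Fin (r + 1) → E) 𝓘(ℝ, Fin (r + 1) → E) c y :=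
    mdifferentiableAt_atlas (chart_mem_atlas _ _) (mem_chart_source _ y)
  have h2 : MDifferentiableAt 𝓘(ℝ, Fin (r + 1) → E) 𝓘(ℝ, Fin (s + 1) → E) R (c y) :=
    (hRd _).mdifferentiableAt
  have h3 : MDifferentiableAt 𝓘(ℝ, Fin (s + 1) → E) 𝓘(ℝ, Fin (s + 1) → E) c'.symm (R (c y)) := by
    refine mdifferentiableAt_atlas_symm (chart_mem_atlas _ _) ?_
    rw [hkey y (mem_chart_source _ y)]
    exact c'.map_source (mem_chart_source _ _)
  exact (h3.comp y (h2.comp y h1)).congr_of_eventuallyEq hev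

end Jets


section Cotangent

/-- The exterior derivative of a `1`-form `η` on a manifold, evaluated at `x` on `u, v`: in the
chart at `x` it is `D η(u)(v) - D η(v)(u)`. -/
def extDerivOneForm {F H M : Type*} [NormedAddCommGroup F] [NormedSpace ℝ F] [TopologicalSpace H]
    (I : ModelWithCorners ℝ F H) [TopologicalSpace M] [ChartedSpace H M]
    (η : ∀ x : M, TangentSpace I x →L[ℝ] ℝ) (x : M) (u v : TangentSpace I x) : ℝ :=
  let w : F → F →L[ℝ] ℝ := fun z =>
    (η ((extChartAt I x).symm z)).comp (mfderiv 𝓘(ℝ, F) I (extChartAt I x).symm z)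
  fderiv ℝ w (extChartAt I x x) u v - fderiv ℝ w (extChartAt I x x) v u

variable (F : Type*) [NormedAddCommGroup F] [NormedSpace ℝ F]
  (M : Type*) [TopologicalSpace M] [ChartedSpace F M] [IsManifold 𝓘(ℝ, F) ∞ M]

/-- The cotangent bundle `T^* M` of a manifold `M` modelled on `F`. -/
abbrev CotangentBundle : Type _ :=
  Bundle.TotalSpace (F →L[ℝ] ℝ) (fun x : M => TangentSpace 𝓘(ℝ, F) x →L[ℝ] Bundle.Trivial M ℝ x)

/-- The model of the manifold `T^* M`. -/
abbrev cotangentModel : ModelWithCorners ℝ (F × (F →L[ℝ] ℝ)) (ModelProd F (F →L[ℝ] ℝ)) :=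
  𝓘(ℝ, F).prod 𝓘(ℝ, F →L[ℝ] ℝ)

variable {F M}

/-- The projection `π_M : T^* M → M`. -/
def cotangentProj (b : CotangentBundle F M) : M := b.proj

/-- The canonical Liouville `1`-form on `T^* M`: `θ_b(u) = ⟨b, Tπ_M(u)⟩`. -/
def liouvilleForm (b : CotangentBundle F M) : TangentSpace (cotangentModel F) b →L[ℝ] ℝ :=
  ContinuousLinearMap.comp (show TangentSpace 𝓘(ℝ, F) b.proj →L[ℝ] ℝ from b.snd)
    (mfderiv (cotangentModel F) 𝓘(ℝ, F) (cotangentProj (F := F) (M := M)) b)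

/-- The canonical symplectic form `ω = -dθ` on `T^* M`. -/
def canonicalSymplecticForm (b : CotangentBundle F M)
    (u v : TangentSpace (cotangentModel F) b) : ℝ :=
  -extDerivOneForm (cotangentModel F) (liouvilleForm (F := F) (M := M)) b u v

/-- In canonical coordinates, `ω = dq ∧ dp`. -/
theorem canonicalSymplecticForm_apply (b : CotangentBundle F M)
    (u v : F × (F →L[ℝ] ℝ)) :
    canonicalSymplecticForm (F := F) (M := M) b u v = v.2 u.1 - u.2 v.1 := by
  set z₀ : F × (F →L[ℝ] ℝ) := extChartAt (cotangentModel F) b b with hz₀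
  set c := extChartAt (cotangentModel F) b with hc
  set w : F × (F →L[ℝ] ℝ) → F × (F →L[ℝ] ℝ) →L[ℝ] ℝ := fun z =>
    (liouvilleForm (F := F) (M := M) (c.symm z)).comp
      (mfderiv 𝓘(ℝ, F × (F →L[ℝ] ℝ)) (cotangentModel F) c.symm z) with hw
  set w' : F × (F →L[ℝ] ℝ) →L[ℝ] F × (F →L[ℝ] ℝ) →L[ℝ] ℝ :=
    ((ContinuousLinearMap.compL ℝ (F × (F →L[ℝ] ℝ)) F ℝ).flip
      (ContinuousLinearMap.fst ℝ F (F →L[ℝ] ℝ))).comp (ContinuousLinearMap.snd ℝ F (F →L[ℝ] ℝ))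
    with hw'
  have hw'_apply : ∀ z y : F × (F →L[ℝ] ℝ), w' z y = z.2 y.1 := fun z y => rfl
  have hnhds : c.target ∈ 𝓝 z₀ := extChartAt_target_mem_nhds b
  have htarget : ∀ z ∈ c.target, z.1 ∈ (extChartAt 𝓘(ℝ, F) b.proj).target := by
    intro z hz
    rw [hc, FiberBundle.extChartAt_target] at hz
    exact hz.1.1
  have hsymm : ∀ z ∈ c.target, cotangentProj (c.symm z) =
      (extChartAt 𝓘(ℝ, F) b.proj).symm z.1 := by
    intro z hz
    rw [hc, FiberBundle.extChartAt]
    rfl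
  have hev : w =ᶠ[𝓝 z₀] fun z => w' z := by
    filter_upwards [eventually_mem_nhds_iff.mpr hnhds] with z hzn
    have hz : z ∈ c.target := mem_of_mem_nhds hzn
    have hpz := htarget z hz
    set p : M := (extChartAt 𝓘(ℝ, F) b.proj).symm z.1 with hp
    have hps : p ∈ (chartAt F b.proj).source := by
      rw [← extChartAt_source 𝓘(ℝ, F)]
      exact (extChartAt 𝓘(ℝ, F) b.proj).map_target hpz
    have hB : c.symm z = (⟨p, ContinuousLinearMap.comp
        ((trivializationAt ℝ (Bundle.Trivial M ℝ) b.proj).symmL ℝ p)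
        (z.2.comp ((trivializationAt F (TangentSpace 𝓘(ℝ, F)) b.proj).continuousLinearMapAt ℝ p))⟩ :
        CotangentBundle F M) := by
      rw [hc, FiberBundle.extChartAt]
      rfl
    have hS : ∀ β : CotangentBundle F M, β = c.symm z → ∀ d : TangentSpace 𝓘(ℝ, F) β.proj,
        β.snd d = z.2 (mfderiv 𝓘(ℝ, F) 𝓘(ℝ, F) (extChartAt 𝓘(ℝ, F) b.proj) β.proj d) := by
      rintro β hβ
      rw [hB] at hβ
      subst hβ
      intro d
      rw [TangentBundle.continuousLinearMapAt_trivializationAt hps]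
      simp [Bundle.Trivial.symmL_trivialization]
      rfl
    refine ContinuousLinearMap.ext fun y => ?_
    have h1 : w z y = (c.symm z).snd (mfderiv (cotangentModel F) 𝓘(ℝ, F)
        (cotangentProj (F := F) (M := M)) (c.symm z)
        (mfderiv 𝓘(ℝ, F × (F →L[ℝ] ℝ)) (cotangentModel F) c.symm z y)) := rfl
    refine (h1.trans (hS _ rfl _)).trans (congrArg z.2 (?_ : _ = y.1))
    have hm1 : MDifferentiableAt 𝓘(ℝ, F × (F →L[ℝ] ℝ)) (cotangentModel F) c.symm z := by
      have := mdifferentiableWithinAt_extChartAt_symm (I := cotangentModel F) hz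
      rwa [ModelWithCorners.range_eq_univ, mdifferentiableWithinAt_univ] at this
    have hm2 : MDifferentiableAt (cotangentModel F) 𝓘(ℝ, F)
        (cotangentProj (F := F) (M := M)) (c.symm z) :=
      Bundle.mdifferentiableAt_proj (fun x : M => TangentSpace 𝓘(ℝ, F) x →L[ℝ] Bundle.Trivial M ℝ x)
    have hpp : cotangentProj (c.symm z) = p := hsymm z hz
    have hm3 : MDifferentiableAt 𝓘(ℝ, F) 𝓘(ℝ, F) (extChartAt 𝓘(ℝ, F) b.proj)
        (cotangentProj (c.symm z)) :=
      mdifferentiableAt_extChartAt (by rw [hpp]; exact hps)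
    have hfst : (extChartAt 𝓘(ℝ, F) b.proj ∘ cotangentProj ∘ c.symm) =ᶠ[𝓝 z]
        (Prod.fst : F × (F →L[ℝ] ℝ) → F) := by
      filter_upwards [hzn] with x hx
      simp only [Function.comp_apply, hsymm x hx]
      exact (extChartAt 𝓘(ℝ, F) b.proj).right_inv (htarget x hx)
    have hcomp := hfst.mfderiv_eq (I := 𝓘(ℝ, F × (F →L[ℝ] ℝ))) (I' := 𝓘(ℝ, F))
    rw [mfderiv_comp z hm3 (hm2.comp z hm1), mfderiv_comp z hm2 hm1, mfderiv_eq_fderiv,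
      fderiv_fst] at hcomp
    exact DFunLike.congr_fun hcomp y
  have hd : fderiv ℝ w z₀ = w' := by
    rw [hev.fderiv_eq]
    exact ContinuousLinearMap.fderiv (𝕜 := ℝ) (E := F × (F →L[ℝ] ℝ))
      (F := F × (F →L[ℝ] ℝ) →L[ℝ] ℝ) w'
  have : canonicalSymplecticForm (F := F) (M := M) b u v =
      -(fderiv ℝ w z₀ u v - fderiv ℝ w z₀ v u) := rfl
  rw [this, hd, hw'_apply, hw'_apply]
  ring

/-- `X` is the Hamiltonian vector field of `h`: a smooth vector field on `T^* M` such that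
`i(X) ω = dh`. -/
def IsHamiltonianVectorField (h : CotangentBundle F M → ℝ)
    (X : ∀ b : CotangentBundle F M, TangentSpace (cotangentModel F) b) : Prop :=
  ContMDiff (cotangentModel F) (cotangentModel F).tangent ∞
      (fun b => (⟨b, X b⟩ : TangentBundle (cotangentModel F) (CotangentBundle F M))) ∧
    ∀ (b : CotangentBundle F M) (u : TangentSpace (cotangentModel F) b),
      canonicalSymplecticForm b (X b) u = mfderiv (cotangentModel F) 𝓘(ℝ, ℝ) h b u

/-- A `1`-form `α` on `M`, as a section `M → T^* M`. -/
def formSection (α : ∀ x : M, TangentSpace 𝓘(ℝ, F) x →L[ℝ] ℝ) (x : M) : CotangentBundle F M :=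
  ⟨x, α x⟩

/-- Smooth `1`-forms on `M`. -/
def IsSmoothOneForm (α : ∀ x : M, TangentSpace 𝓘(ℝ, F) x →L[ℝ] ℝ) : Prop :=
  ContMDiff 𝓘(ℝ, F) (cotangentModel F) ∞ (formSection α)

/-- Closed `1`-forms on `M`: `dα = 0`. -/
def IsClosedOneForm (α : ∀ x : M, TangentSpace 𝓘(ℝ, F) x →L[ℝ] ℝ) : Prop :=
  ∀ (x : M) (u v : TangentSpace 𝓘(ℝ, F) x), extDerivOneForm 𝓘(ℝ, F) α x u v = 0

/-- The vector field `Tπ_M ∘ X ∘ α` on `M` associated to a `1`-form `α` and a vector field `X`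
on `T^* M`. -/
def associatedVectorField (X : ∀ b : CotangentBundle F M, TangentSpace (cotangentModel F) b)
    (α : ∀ x : M, TangentSpace 𝓘(ℝ, F) x →L[ℝ] ℝ) (x : M) : TangentSpace 𝓘(ℝ, F) x :=
  mfderiv (cotangentModel F) 𝓘(ℝ, F) (cotangentProj (F := F) (M := M)) (formSection α x)
    (X (formSection α x))

/-- `α` is a solution to the generalized Hamiltonian Hamilton-Jacobi problem for `X`: whenever
`γ`, defined on an open interval `J`, is an integral curve of `Tπ_M ∘ X ∘ α`, the curve `α ∘ γ`
is an integral curve of `X`. -/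
def IsGeneralizedHJSolution (X : ∀ b : CotangentBundle F M, TangentSpace (cotangentModel F) b)
    (α : ∀ x : M, TangentSpace 𝓘(ℝ, F) x →L[ℝ] ℝ) : Prop :=
  IsSmoothOneForm α ∧
    ∀ (J : Set ℝ) (γ : ℝ → M), IsOpen J → J.OrdConnected →
      IsMIntegralCurveOn γ (associatedVectorField X α) J →
        IsMIntegralCurveOn (fun t => formSection α (γ t)) X J

/-- `α` is a solution to the Hamiltonian Hamilton-Jacobi problem for `X`: a closed solution to
the generalized problem. -/
def IsHJSolution (X : ∀ b : CotangentBundle F M, TangentSpace (cotangentModel F) b)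
    (α : ∀ x : M, TangentSpace 𝓘(ℝ, F) x →L[ℝ] ℝ) : Prop :=
  IsClosedOneForm α ∧ IsGeneralizedHJSolution X α

end Cotangent

section Semispray

variable {E : Type*} [NormedAddCommGroup E] [NormedSpace ℝ E] {r : ℕ}
  {Q : Type*} [TopologicalSpace Q] [ChartedSpace E Q] [IsManifold 𝓘(ℝ, E) ∞ Q]

/-- A curve `ψ` in `T^r Q` is holonomic (of type `1`) on `J`: there `φ = β^r ∘ ψ` is a smooth
curve in `Q` and `ψ` is its canonical lifting `j^r φ`. -/
def IsHolonomicOn (ψ : ℝ → HTangent E r Q) (J : Set ℝ) : Prop :=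
  ∀ t ∈ J, ∃ h : ContMDiffAt 𝓘(ℝ, ℝ) 𝓘(ℝ, E) ∞ (fun s => (ψ s).base) t,
    ψ t = jetLift r (fun s => (ψ s).base) t h

/-- Semisprays of type `1` on `T^r Q`: all integral curves, on all open intervals, are
holonomic. -/
def IsSemispray (X : ∀ y : HTangent E r Q, TangentSpace 𝓘(ℝ, Fin (r + 1) → E) y) : Prop :=
  ∀ (J : Set ℝ) (ψ : ℝ → HTangent E r Q), IsOpen J → J.OrdConnected →
    IsMIntegralCurveOn ψ X J → IsHolonomicOn ψ J

end Semispray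

section Lagrangian

variable {E : Type*} [NormedAddCommGroup E] [NormedSpace ℝ E]

/-- The iterated total time derivative `d_T^i f`, in natural coordinates, of a function
`f(q₀, …, q_k)`, at a jet with coordinates `z`: since `(d_T^i f)(j^{k+i} c) = (d/dt)^i (f (j^k c))`
for every curve `c`, it is computed along the polynomial curve whose jet at `0` is `z`.
(The value only depends on `z₀, …, z_{k+i}`, and is only used when these are coordinates of
`z`.) -/
def totalDeriv {V : Type*} [NormedAddCommGroup V] [NormedSpace ℝ V] {k s : ℕ} (i : ℕ)
    (f : (Fin (k + 1) → E) → V) (z : Fin (s + 1) → E) : V :=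
  iteratedDeriv i (fun t : ℝ => f (fun a => iteratedDeriv a (polyCurve z) t)) 0

/-- The partial derivative `∂f/∂q_l`, as a covector on `E`: its component of index `A` is
`∂f/∂q_l^A`. -/
def partialDeriv {k : ℕ} (f : (Fin (k + 1) → E) → ℝ) (l : Fin (k + 1)) (z : Fin (k + 1) → E) :
    E →L[ℝ] ℝ :=
  (fderiv ℝ f z).comp (ContinuousLinearMap.single ℝ (fun _ : Fin (k + 1) => E) l)

/-- The Jacobi-Ostrogradsky momenta of a Lagrangian of order `k = m + 1`, given in natural
coordinates by `f(q₀, …, q_k)`, at a point with coordinates `z = (q₀, …, q_{2k-1})`: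
`p̂^j = ∑_{i=0}^{k-(j+1)} (-1)^i d_T^i (∂f/∂q_{j+1+i})`, for `0 ≤ j ≤ k - 1`. -/
def ostrogradskyMomentum {m : ℕ} (f : (Fin (m + 1 + 1) → E) → ℝ) (j : Fin (m + 1))
    (z : Fin (2 * m + 1 + 1) → E) : E →L[ℝ] ℝ :=
  ∑ i : Fin (m - j + 1),
    (-1 : ℝ) ^ (i : ℕ) • totalDeriv i (partialDeriv f ⟨j + 1 + i, by omega⟩) z

variable {Q : Type*} [TopologicalSpace Q] [ChartedSpace E Q] [IsManifold 𝓘(ℝ, E) ∞ Q] {m : ℕ}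

/-- The Lagrangian read in the natural chart of `T^k Q`, `k = m + 1`, induced by the chart of `Q`
at `x`. -/
def localLagrangian (L : HTangent E (m + 1) Q → ℝ) (x : Q) : (Fin (m + 1 + 1) → E) → ℝ :=
  fun z => L ((natChart (m + 1) (chartAt E x) (chart_mem_atlas E x)).symm z)

/-- The natural coordinates `(q₀, …, q_r)` of a point of `T^r Q`, in the preferred chart of `Q` at
its base point. (The global objects defined from these coordinates below do not depend on the
chart.) -/
def coords {r : ℕ} (y : HTangent E r Q) : Fin (r + 1) → E :=
  natChart r (chartAt E y.base) (chart_mem_atlas E y.base) y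

/-- The momenta `p̂^j` at a point of `T^{2k-1} Q`, in natural coordinates around that point. -/
def momentum (L : HTangent E (m + 1) Q → ℝ) (y : HTangent E (2 * m + 1) Q) (j : Fin (m + 1)) :
    E →L[ℝ] ℝ :=
  ostrogradskyMomentum (localLagrangian L y.base) j (coords y)

/-- The Lagrangian energy `E_L = ∑_{r=1}^k q_r p̂^{r-1} - L` on `T^{2k-1} Q`, `k = m + 1`. -/
def lagrangianEnergy (L : HTangent E (m + 1) Q → ℝ) (y : HTangent E (2 * m + 1) Q) : ℝ :=
  ∑ j : Fin (m + 1), momentum L y j (coords y ⟨j + 1, by omega⟩) -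
    L (y.proj (show m + 1 ≤ 2 * m + 1 by omega))

/-- The coordinate `1`-forms `dq_j` on `T^r Q` (with values in `E`: the components are the
`dq_j^A`) at a point `x`, for the natural chart induced by the chart of `Q` at the base point. -/
def coordForm {r : ℕ} (x : HTangent E r Q) (j : Fin (r + 1)) :
    TangentSpace 𝓘(ℝ, Fin (r + 1) → E) x →L[ℝ] E :=
  (ContinuousLinearMap.proj j).comp
    (mfderiv 𝓘(ℝ, Fin (r + 1) → E) 𝓘(ℝ, Fin (r + 1) → E)
      (natChart r (chartAt E x.base) (chart_mem_atlas E x.base)) x)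

/-- The Poincaré-Cartan `1`-form `θ_L = ∑_{j=0}^{k-1} p̂^j dq_j` on `T^{2k-1} Q`. -/
def poincareCartanForm (L : HTangent E (m + 1) Q → ℝ) (y : HTangent E (2 * m + 1) Q) :
    TangentSpace 𝓘(ℝ, Fin (2 * m + 1 + 1) → E) y →L[ℝ] ℝ :=
  ∑ j : Fin (m + 1), (momentum L y j).comp (coordForm y (Fin.castLE (by omega) j))

/-- The covector `∑_{j=0}^{k-1} p̂^j(y) dq_j` at a point `x` of `T^{k-1} Q`. -/
def momentumCovector (L : HTangent E (m + 1) Q → ℝ) (y : HTangent E (2 * m + 1) Q)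
    (x : HTangent E m Q) : TangentSpace 𝓘(ℝ, Fin (m + 1) → E) x →L[ℝ] ℝ :=
  ∑ j : Fin (m + 1), (momentum L y j).comp (coordForm x j)

/-- The Legendre-Ostrogradsky map `FL : T^{2k-1} Q → T^*(T^{k-1} Q)`: it covers `ρ^{2k-1}_{k-1}`
and reads `p^j ∘ FL = p̂^j` in natural coordinates. -/
def legendreOstrogradsky (L : HTangent E (m + 1) Q → ℝ) (y : HTangent E (2 * m + 1) Q) :
    CotangentBundle (Fin (m + 1) → E) (HTangent E m Q) :=
  formSection (momentumCovector L y) (y.proj (show m ≤ 2 * m + 1 by omega))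

theorem coordForm_proj {r s : ℕ} (hs : s ≤ r) (y : HTangent E r Q) (j : Fin (s + 1))
    (u : TangentSpace 𝓘(ℝ, Fin (r + 1) → E) y) :
    coordForm (y.proj hs) j (mfderiv 𝓘(ℝ, Fin (r + 1) → E) 𝓘(ℝ, Fin (s + 1) → E)
      (HTangent.proj (E := E) (Q := Q) hs) y u) =
      coordForm y (Fin.castLE (Nat.succ_le_succ hs) j) u := by
  have hsrcy : y.base ∈ (chartAt E y.base).source := mem_chart_source E _
  have hee : chartAt E (y.proj hs).base = chartAt E y.base := by rw [base_proj]
  set c := chartAt (Fin (r + 1) → E) y with hc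
  set c' := chartAt (Fin (s + 1) → E) (y.proj hs) with hc'
  set R : (Fin (r + 1) → E) →L[ℝ] (Fin (s + 1) → E) :=
    ContinuousLinearMap.pi fun i => ContinuousLinearMap.proj (Fin.castLE (Nat.succ_le_succ hs) i)
    with hR
  have h1 : MDifferentiableAt 𝓘(ℝ, Fin (r + 1) → E) 𝓘(ℝ, Fin (r + 1) → E) c y :=
    mdifferentiableAt_atlas (chart_mem_atlas _ _) (mem_chart_source _ y)
  have h2 : MDifferentiableAt 𝓘(ℝ, Fin (s + 1) → E) 𝓘(ℝ, Fin (s + 1) → E) c' (y.proj hs) :=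
    mdifferentiableAt_atlas (chart_mem_atlas _ _) (mem_chart_source _ _)
  have h3 : MDifferentiableAt 𝓘(ℝ, Fin (r + 1) → E) 𝓘(ℝ, Fin (s + 1) → E) R (c y) :=
    R.differentiableAt.mdifferentiableAt
  have hev : (c' ∘ HTangent.proj (E := E) (Q := Q) hs) =ᶠ[𝓝 y] (R ∘ c) := by
    filter_upwards [c.open_source.mem_nhds (mem_chart_source _ y)] with y' hy'
    change natCoord s (chartAt E (y.proj hs).base) (y'.proj hs) = R (natCoord r _ y')
    rw [hee, natCoord_proj hs (chart_mem_atlas E _) y' hy']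
    rfl
  have hm := hev.mfderiv_eq (I := 𝓘(ℝ, Fin (r + 1) → E)) (I' := 𝓘(ℝ, Fin (s + 1) → E))
  rw [mfderiv_comp y h2 (mdifferentiableAt_proj hs y), mfderiv_comp y h3 h1,
    mfderiv_eq_fderiv, R.fderiv] at hm
  exact congrFun (DFunLike.congr_fun hm u) j

/-- The defining property of the Legendre-Ostrogradsky map:
`θ_L(u) = ⟨Tρ^{2k-1}_{k-1}(u), FL(y)⟩` for `u` tangent at `y`. -/
theorem poincareCartanForm_eq (L : HTangent E (m + 1) Q → ℝ) (y : HTangent E (2 * m + 1) Q)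
    (u : TangentSpace 𝓘(ℝ, Fin (2 * m + 1 + 1) → E) y) :
    poincareCartanForm L y u =
      (show TangentSpace 𝓘(ℝ, Fin (m + 1) → E) (y.proj (show m ≤ 2 * m + 1 by omega)) →L[ℝ] ℝ
        from (legendreOstrogradsky L y).snd)
      (mfderiv 𝓘(ℝ, Fin (2 * m + 1 + 1) → E) 𝓘(ℝ, Fin (m + 1) → E)
        (HTangent.proj (E := E) (Q := Q) (show m ≤ 2 * m + 1 by omega)) y u) := by
  have h1 : poincareCartanForm L y u = ∑ j : Fin (m + 1), momentum L y j
      (coordForm y (Fin.castLE (by omega) j) u) := by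
    simp only [poincareCartanForm, sum_apply]
    rfl
  have h2 : ∀ v : TangentSpace 𝓘(ℝ, Fin (m + 1) → E) (y.proj (show m ≤ 2 * m + 1 by omega)),
      momentumCovector L y (y.proj (show m ≤ 2 * m + 1 by omega)) v =
      ∑ j : Fin (m + 1), momentum L y j
        (coordForm (y.proj (show m ≤ 2 * m + 1 by omega)) j v) := by
    intro v
    simp only [momentumCovector, sum_apply]
    rfl
  refine h1.trans (Eq.trans ?_ (h2 _).symm)
  exact Finset.sum_congr rfl fun j _ => congrArg _ (coordForm_proj _ y j u).symm

/-- `L` is hyperregular: `FL` is a global diffeomorphism. -/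
def IsHyperregular (L : HTangent E (m + 1) Q → ℝ) : Prop :=
  ∃ Φ : Diffeomorph 𝓘(ℝ, Fin (2 * m + 1 + 1) → E) (cotangentModel (Fin (m + 1) → E))
    (HTangent E (2 * m + 1) Q) (CotangentBundle (Fin (m + 1) → E) (HTangent E m Q)) ∞,
    ∀ y, Φ y = legendreOstrogradsky L y

/-- `h` is the Hamiltonian function associated to `L`: the smooth function on `T^*(T^{k-1} Q)`
such that `FL^* h = E_L`. -/
def IsAssociatedHamiltonian (L : HTangent E (m + 1) Q → ℝ)
    (h : CotangentBundle (Fin (m + 1) → E) (HTangent E m Q) → ℝ) : Prop :=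
  ContMDiff (cotangentModel (Fin (m + 1) → E)) 𝓘(ℝ, ℝ) ∞ h ∧
    ∀ y, h (legendreOstrogradsky L y) = lagrangianEnergy L y

end Lagrangian

end HigherOrder

end

open HigherOrder

namespace HigherOrder

open Set

/-! ### Natural charts of T^r Q and prolongations of smooth maps -/

section ChartChange

variable {E : Type*} [NormedAddCommGroup E] [NormedSpace ℝ E] {r : ℕ}
  {Q : Type*} [TopologicalSpace Q] [ChartedSpace E Q] [IsManifold 𝓘(ℝ, E) ∞ Q]

/-! Write k = m + 1. In natural coordinates put (q, p) = FL(y). Then h(q, p) = ∑ p_j · q_{j+1}(y) -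
L(q_0, …, q_k)(y), where y = FL⁻¹(q, p) depends smoothly on (q, p) by hyperregularity. Fix q and
vary p. Since FL covers the projection to T^{k-1}Q, the coordinates q_0, …, q_{k-1} of y stay
constant, and in the derivative of h the only contribution of the motion of y is (p_{k-1} - ∂L/∂q_k)
· δq_k. It vanishes because the top momentum is exactly ∂L/∂q_k. Hence ∂h/∂p_j = q_{j+1}(y), so by
Hamilton's equations Tπ(X_h) at FL(y) has components (q_1(y), …, q_k(y)); this is
`mfderiv_cotangentProj_hamiltonianVectorField`.

Take FL(y) = α(x). Then y projects to x, so all these components but the last are coordinates of x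
itself: X(x) = (q_1(x), …, q_{k-1}(x), *). The integral curves of X satisfy q_i' = q_{i+1} for i < k
- 1, which says that they are lifts of their projections to Q (`isSemispray_of_castSucc`).

The last implication needs two complements. An integral curve is followed in one fixed chart while
the components of X are known in the chart centred at each point; the condition w_i = q_{i+1} is
independent of the chart (`tangentCoordChange_castSucc`). Integral curves are a priori only
differentiable; the smoothness of X makes them smooth (`contDiffOn_of_hasDerivAt_comp`). -/

theorem natCoord_natPoint {e e' : OpenPartialHomeomorph Q E} (he : e ∈ atlas E Q)
    (he' : e' ∈ atlas E Q) {z : Fin (r + 1) → E} (h : z 0 ∈ e.target)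
    (h' : e.symm (z 0) ∈ e'.source) (i : Fin (r + 1)) :
    natCoord r e' (natPoint r e he z) i = iteratedDeriv i ((e' ∘ e.symm) ∘ polyCurve z) 0 := by
  rw [natPoint, dif_pos h, natCoord_jetZero r he']
  · rfl
  · simpa [polyCurve_zero] using h'

theorem natCoord_zero (e : OpenPartialHomeomorph Q E) (he : e ∈ atlas E Q) (y : HTangent E r Q)
    (hy : y.base ∈ e.source) : natCoord r e y 0 = e y.base := by
  induction y using Quotient.inductionOn with
  | h φ =>
    change natCoord r e (jetZero r φ.1 φ.2) 0 = e (φ.1 0)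
    rw [natCoord_jetZero r he _ _ hy]
    simp [curveCoord]

/-- In the model space, lifting commutes with smooth maps to first order: the derivative of the
`r`-th prolongation of `g` sends a vector `w` with `w_i = z_{i+1}` to a vector with the same
property. -/
theorem hasFDerivAt_prolongation_apply {F : Type*} [NormedAddCommGroup F] [NormedSpace ℝ F]
    {g : E → F} {V : Set E} (hV : IsOpen V) (hg : ContDiffOn ℝ ∞ g V)
    {τ : (Fin (r + 1) → E) → Fin (r + 1) → F} {z w : Fin (r + 1) → E} (hz : z 0 ∈ V)
    (hτ : ∀ ζ : Fin (r + 1) → E, ζ 0 ∈ V →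
      ∀ i : Fin (r + 1), τ ζ i = iteratedDeriv i (g ∘ polyCurve ζ) 0)
    {D : (Fin (r + 1) → E) →L[ℝ] Fin (r + 1) → F} (hD : HasFDerivAt τ D z)
    (hw : ∀ i : Fin r, w i.castSucc = z i.succ) (j : Fin r) :
    D w j.castSucc = τ z j.succ := by
  set p := polyCurve z with hp
  have hpc : ContDiff ℝ ∞ p := contDiff_polyCurve z
  have hsm : ∀ i : ℕ, Differentiable ℝ (iteratedDeriv i p) := fun i =>
    hpc.differentiable_iteratedDeriv i (by exact_mod_cast WithTop.coe_lt_top i)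
  -- The velocity at 0 of the jet lift of `p`. It agrees with `w` except possibly in the last slot.
  set w' : Fin (r + 1) → E := fun i => iteratedDeriv (i + 1) p 0 with hw'
  have hww : ∀ i : Fin r, (w - w') i.castSucc = 0 := by
    intro i
    have := iteratedDeriv_polyCurve z i.succ
    simp only [Fin.val_succ] at this
    simp [hw', hw, hp, this]
  -- The jet lift of `p`, corrected in the last slot only, so that its velocity at 0 is exactly `w`.
  set c : ℝ → Fin (r + 1) → E := fun t i => iteratedDeriv i p t + t • (w - w') i with hc
  have hc0 : c 0 = z := by
    funext i
    simp [hc, hp, iteratedDeriv_polyCurve]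
  have hcd : HasDerivAt c w 0 := by
    rw [hasDerivAt_pi]
    intro i
    have h1 : HasDerivAt (iteratedDeriv i p) (w' i) 0 := by
      have := (hsm i 0).hasDerivAt
      rwa [← iteratedDeriv_succ] at this
    have h2 := h1.add ((hasDerivAt_id (0 : ℝ)).smul_const ((w - w') i))
    simp only [id_eq, one_smul, Pi.sub_apply, add_sub_cancel] at h2
    exact h2
  have hcomp : HasDerivAt (fun t => τ (c t) j.castSucc) (D w j.castSucc) 0 := by
    have := (hc0 ▸ hD : HasFDerivAt τ D (c 0)).comp_hasDerivAt 0 hcd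
    exact (hasDerivAt_pi.1 this) j.castSucc
  have hcV : ∀ᶠ t in 𝓝 (0 : ℝ), c t 0 ∈ V := by
    have : ContinuousAt (fun t => c t 0) 0 := (hasDerivAt_pi.1 hcd 0).continuousAt
    exact this.preimage_mem_nhds (hV.mem_nhds (by simpa [hc0] using hz))
  have hpV : ∀ᶠ t in 𝓝 (0 : ℝ), p t ∈ V :=
    hpc.continuous.continuousAt.preimage_mem_nhds
      (hV.mem_nhds (by simpa [hp, polyCurve_zero] using hz))
  have hev : (fun t => τ (c t) j.castSucc) =ᶠ[𝓝 0] iteratedDeriv j (g ∘ p) := by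
    filter_upwards [hcV, hpV] with t ht htp
    have hshift : ∀ i : ℕ, iteratedDeriv i (fun s => p (t + s)) 0 = iteratedDeriv i p t := by
      intro i
      simpa using congrFun (iteratedDeriv_comp_const_add i p t) 0
    have hshift' : iteratedDeriv j (fun s => (g ∘ p) (t + s)) 0 = iteratedDeriv j (g ∘ p) t := by
      simpa using congrFun (iteratedDeriv_comp_const_add (j : ℕ) (g ∘ p) t) 0
    rw [hτ _ ht, ← hshift']
    -- Component `j < r` of the prolongation depends only on derivatives of order at most `j`, and
    -- in those slots `c t` is the jet of `p` at `t`.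
    refine iteratedDeriv_comp_congr (g := g) (c := polyCurve (c t)) (d := fun s => p (t + s))
      (r := j) ?_ (contDiff_polyCurve _).contDiffAt
      (hpc.comp (contDiff_const.add contDiff_id)).contDiffAt ?_ j le_rfl
    · rw [polyCurve_zero]
      exact hg.contDiffAt (hV.mem_nhds ht)
    · intro i hi
      have hir : i < r := lt_of_le_of_lt hi j.2
      have h1 := iteratedDeriv_polyCurve (c t) (Fin.castSucc ⟨i, hir⟩)
      rw [hshift]
      refine h1.trans ?_
      simp only [hc, hww, smul_zero, add_zero]
      rfl
  have hd := (hcomp.congr_of_eventuallyEq hev.symm).deriv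
  rw [← iteratedDeriv_succ] at hd
  rw [hτ z hz, ← hd]
  rfl

/-- The condition `w_i = q_{i+1}`, `i < r`, on vectors `w` tangent to `T^r Q` does not depend on the
natural chart. -/
theorem tangentCoordChange_castSucc {y y₀ : HTangent E r Q}
    (hy : y.base ∈ (chartAt E y₀.base).source) {w : Fin (r + 1) → E}
    (hw : ∀ i : Fin r, w i.castSucc = coords y i.succ) (j : Fin r) :
    tangentCoordChange 𝓘(ℝ, Fin (r + 1) → E) y y₀ y w j.castSucc =
      natCoord r (chartAt E y₀.base) y j.succ := by
  set e := chartAt E y.base with he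
  set e₀ := chartAt E y₀.base with he₀
  have hea : e ∈ atlas E Q := chart_mem_atlas E _
  have hea₀ : e₀ ∈ atlas E Q := chart_mem_atlas E _
  have hys : y.base ∈ e.source := mem_chart_source E _
  have hD := hasFDerivWithinAt_tangentCoordChange (I := 𝓘(ℝ, Fin (r + 1) → E)) (x := y) (y := y₀)
    (z := y) (by
      rw [extChartAt_source, extChartAt_source]
      exact ⟨mem_chart_source _ y, hy⟩)
  rw [ModelWithCorners.range_eq_univ, hasFDerivWithinAt_univ] at hD
  have hz0 : coords y 0 = e y.base := natCoord_zero e hea y hys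
  -- The transition map between natural charts is the prolongation of the transition map of `Q`.
  have hτ : ∀ ζ : Fin (r + 1) → E, ζ 0 ∈ e.target ∩ e.symm ⁻¹' e₀.source → ∀ i : Fin (r + 1),
      (extChartAt 𝓘(ℝ, Fin (r + 1) → E) y₀ ∘ (extChartAt 𝓘(ℝ, Fin (r + 1) → E) y).symm) ζ i =
        iteratedDeriv i ((e₀ ∘ e.symm) ∘ polyCurve ζ) 0 := fun ζ hζ i =>
    natCoord_natPoint hea hea₀ hζ.1 hζ.2 i
  have key := hasFDerivAt_prolongation_apply (e.isOpen_inter_preimage_symm e₀.open_source)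
    (contDiffOn_transition hea hea₀) (z := coords y) (w := w)
    (by
      rw [hz0]
      exact ⟨e.map_source hys, by simpa [e.left_inv hys] using hy⟩) hτ hD hw j
  refine key.trans ?_
  have hinv : (extChartAt 𝓘(ℝ, Fin (r + 1) → E) y).symm (coords y) = y := extChartAt_to_inv y
  rw [Function.comp_apply, hinv]
  rfl

end ChartChange

/-! ### Regularity of solutions of autonomous equations -/

section Smoothness

/-- Bootstrapping: if `z` is C^k, then so is z' = G ∘ z, hence `z` is C^(k+1). -/
theorem contDiffOn_of_hasDerivAt_comp {F : Type*} [NormedAddCommGroup F] [NormedSpace ℝ F]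
    {G : F → F} {T : Set F} {z : ℝ → F} {U : Set ℝ} (hU : IsOpen U) (hG : ContDiffOn ℝ ∞ G T)
    (hzT : MapsTo z U T) (hz : ∀ t ∈ U, HasDerivAt z (G (z t)) t) : ContDiffOn ℝ ∞ z U := by
  rw [contDiffOn_infty]
  intro k
  induction k with
  | zero => exact contDiffOn_zero.2 fun t ht => (hz t ht).continuousAt.continuousWithinAt
  | succ k ih =>
    push_cast
    rw [contDiffOn_succ_iff_deriv_of_isOpen hU]
    refine ⟨fun t ht => (hz t ht).differentiableAt.differentiableWithinAt, by simp, ?_⟩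
    exact ((hG.of_le (by exact_mod_cast le_top)).comp ih hzT).congr fun t ht => (hz t ht).deriv

end Smoothness

/-- Tangent vectors are stored in the preferred charts, so the manifold derivative is the Fréchet
derivative of the local expression; without boundary the range of the model is everything. -/
theorem hasFDerivAt_writtenInExtChartAt {F F' H H' M M' : Type*} [NormedAddCommGroup F]
    [NormedSpace ℝ F] [NormedAddCommGroup F'] [NormedSpace ℝ F'] [TopologicalSpace H]
    [TopologicalSpace H'] {I : ModelWithCorners ℝ F H} [I.Boundaryless]
    {I' : ModelWithCorners ℝ F' H'} [TopologicalSpace M] [ChartedSpace H M] [TopologicalSpace M']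
    [ChartedSpace H' M'] {f : M → M'} {x : M} (hf : MDifferentiableAt I I' f x) :
    HasFDerivAt (writtenInExtChartAt I I' x f) (show F →L[ℝ] F' from mfderiv I I' f x)
      (extChartAt I x x) := by
  have h : HasFDerivWithinAt (writtenInExtChartAt I I' x f)
    (show F →L[ℝ] F' from mfderiv I I' f x) (range I) (extChartAt I x x) := hf.hasMFDerivAt.2
  rwa [ModelWithCorners.range_eq_univ, hasFDerivWithinAt_univ] at h

/-! ### Canonical coordinates of the cotangent bundle and Hamilton's equations -/

section CotangentCoordinates

variable {F : Type*} [NormedAddCommGroup F] [NormedSpace ℝ F]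
  {M : Type*} [TopologicalSpace M] [ChartedSpace F M] [IsManifold 𝓘(ℝ, F) ∞ M]

theorem proj_extChartAt_cotangent_symm (b : CotangentBundle F M) {z : F × (F →L[ℝ] ℝ)} :
    ((extChartAt (cotangentModel F) b).symm z).proj = (extChartAt 𝓘(ℝ, F) b.proj).symm z.1 := by
  rw [FiberBundle.extChartAt]
  rfl

theorem extChartAt_cotangent_fst (b : CotangentBundle F M) :
    (extChartAt (cotangentModel F) b b).1 = extChartAt 𝓘(ℝ, F) b.proj b.proj := by
  rw [FiberBundle.extChartAt]
  simp

/-- The covector with canonical coordinates `z = (q, p)` is `p ∘ T(chart)`. -/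
theorem snd_extChartAt_cotangent_symm (b : CotangentBundle F M) {z : F × (F →L[ℝ] ℝ)}
    (hz : z.1 ∈ (extChartAt 𝓘(ℝ, F) b.proj).target) (β : CotangentBundle F M)
    (hβ : β = (extChartAt (cotangentModel F) b).symm z) (d : TangentSpace 𝓘(ℝ, F) β.proj) :
    β.snd d = z.2 (mfderiv 𝓘(ℝ, F) 𝓘(ℝ, F) (extChartAt 𝓘(ℝ, F) b.proj) β.proj d) := by
  set p : M := (extChartAt 𝓘(ℝ, F) b.proj).symm z.1 with hp
  have hps : p ∈ (chartAt F b.proj).source := by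
    rw [← extChartAt_source 𝓘(ℝ, F)]
    exact (extChartAt 𝓘(ℝ, F) b.proj).map_target hz
  have hB : (extChartAt (cotangentModel F) b).symm z = (⟨p, ContinuousLinearMap.comp
      ((trivializationAt ℝ (Bundle.Trivial M ℝ) b.proj).symmL ℝ p)
      (z.2.comp ((trivializationAt F (TangentSpace 𝓘(ℝ, F)) b.proj).continuousLinearMapAt ℝ p))⟩ :
      CotangentBundle F M) := by
    rw [FiberBundle.extChartAt]
    rfl
  -- Keeping `β` a variable tied by an equation lets `d` live in the tangent space at `β.proj`
  -- without casts.
  rw [hB] at hβ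
  subst hβ
  rw [TangentBundle.continuousLinearMapAt_trivializationAt hps]
  simp [Bundle.Trivial.symmL_trivialization]
  rfl

/-- In canonical coordinates, `Tπ_M` is the first projection. -/
theorem mfderiv_cotangentProj_apply (b : CotangentBundle F M) (v : F × (F →L[ℝ] ℝ)) :
    mfderiv (cotangentModel F) 𝓘(ℝ, F) (cotangentProj (F := F) (M := M)) b v = v.1 := by
  have hm : MDifferentiableAt (cotangentModel F) 𝓘(ℝ, F) (cotangentProj (F := F) (M := M)) b :=
    Bundle.mdifferentiableAt_proj (fun x : M => TangentSpace 𝓘(ℝ, F) x →L[ℝ] Bundle.Trivial M ℝ x)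
  have h := hasFDerivAt_writtenInExtChartAt hm
  have hev : (Prod.fst : F × (F →L[ℝ] ℝ) → F) =ᶠ[𝓝 (extChartAt (cotangentModel F) b b)]
      writtenInExtChartAt (cotangentModel F) 𝓘(ℝ, F) b (cotangentProj (F := F) (M := M)) := by
    filter_upwards [extChartAt_target_mem_nhds (I := cotangentModel F) b] with z hz
    have hz1 : z.1 ∈ (extChartAt 𝓘(ℝ, F) b.proj).target := by
      rw [FiberBundle.extChartAt_target] at hz
      exact hz.1.1
    have h1 : cotangentProj ((extChartAt (cotangentModel F) b).symm z) = _ :=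
      proj_extChartAt_cotangent_symm b
    simp only [writtenInExtChartAt, Function.comp_apply, h1]
    exact ((extChartAt 𝓘(ℝ, F) b.proj).right_inv hz1).symm
  have h' := h.congr_of_eventuallyEq hev
  exact DFunLike.congr_fun (h'.unique hasFDerivAt_fst) v

/-- The momentum derivatives of a Hamiltonian determine the projection of its vector field. -/
theorem hamiltonianVectorField_fst {h : CotangentBundle F M → ℝ}
    {X : ∀ b : CotangentBundle F M, TangentSpace (cotangentModel F) b}
    (hX : IsHamiltonianVectorField h X) {b : CotangentBundle F M}
    (hh : MDifferentiableAt (cotangentModel F) 𝓘(ℝ, ℝ) h b) (a : F)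
    (ha : ∀ p : F →L[ℝ] ℝ, HasDerivAt (fun s : ℝ => h ((extChartAt (cotangentModel F) b).symm
      (extChartAt (cotangentModel F) b b + s • ((0 : F), p)))) (p a) 0) :
    mfderiv (cotangentModel F) 𝓘(ℝ, F) (cotangentProj (F := F) (M := M)) b (X b) = a := by
  set z₀ : F × (F →L[ℝ] ℝ) := extChartAt (cotangentModel F) b b with hz₀
  refine (mfderiv_cotangentProj_apply b (X b)).trans ?_
  have hd := hasFDerivAt_writtenInExtChartAt hh
  have key : ∀ p : F →L[ℝ] ℝ, p (show F × (F →L[ℝ] ℝ) from X b).1 = p a := by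
    intro p
    -- Pairing with a vertical vector (0, p) isolates the base component of `X b`, since ω = dq ∧
    -- dp.
    have h1 := (canonicalSymplecticForm_apply b (X b) ((0 : F), p)).symm.trans
      (hX.2 b ((0 : F), p))
    have hline : HasDerivAt (fun s : ℝ => z₀ + s • ((0 : F), p)) ((0 : F), p) 0 := by
      simpa using ((hasDerivAt_id (0 : ℝ)).smul_const ((0 : F), p)).const_add z₀
    have hd' : HasFDerivAt (writtenInExtChartAt (cotangentModel F) 𝓘(ℝ, ℝ) b h)
        (show F × (F →L[ℝ] ℝ) →L[ℝ] ℝ from mfderiv (cotangentModel F) 𝓘(ℝ, ℝ) h b) (z₀ + (0 : ℝ) • ((0 : F), p)) := by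
      rw [zero_smul, add_zero]
      exact hd
    have hcomp := hd'.comp_hasDerivAt 0 hline
    have h2 := HasDerivAt.unique hcomp (show HasDerivAt (writtenInExtChartAt (cotangentModel F)
      𝓘(ℝ, ℝ) b h ∘ fun s : ℝ => z₀ + s • ((0 : F), p)) (p a) 0 from ha p)
    have h3 : p (show F × (F →L[ℝ] ℝ) from X b).1 - (show F × (F →L[ℝ] ℝ) from X b).2 0 = _ := h1
    rw [map_zero, sub_zero] at h3
    exact h3.trans h2
  by_contra hne
  -- Continuous functionals separate points (Hahn–Banach).
  obtain ⟨g, hg⟩ := SeparatingDual.exists_separating_of_ne (R := ℝ) (V := F) hne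
  exact hg (key g)

end CotangentCoordinates

/-! ### The momenta and the Lagrangian in coordinates -/

section Legendre

variable {E : Type*} [NormedAddCommGroup E] [NormedSpace ℝ E]
  {Q : Type*} [TopologicalSpace Q] [ChartedSpace E Q] [IsManifold 𝓘(ℝ, E) ∞ Q] {m : ℕ}

/-- The momenta at `y` are the canonical coordinates of `FL(y)`. -/
theorem sum_momentum_apply (L : HTangent E (m + 1) Q → ℝ) (y : HTangent E (2 * m + 1) Q)
    {x : HTangent E m Q} (hx : x = (legendreOstrogradsky L y).proj)
    (P : (Fin (m + 1) → E) →L[ℝ] ℝ)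
    (hP : ∀ d : TangentSpace 𝓘(ℝ, Fin (m + 1) → E) (legendreOstrogradsky L y).proj,
      (legendreOstrogradsky L y).snd d =
        P (mfderiv 𝓘(ℝ, Fin (m + 1) → E) 𝓘(ℝ, Fin (m + 1) → E)
          (extChartAt 𝓘(ℝ, Fin (m + 1) → E) x) (legendreOstrogradsky L y).proj d))
    (u : Fin (m + 1) → E) : ∑ j : Fin (m + 1), momentum L y j (u j) = P u := by
  subst hx
  set x : HTangent E m Q := (legendreOstrogradsky L y).proj with hx
  -- The chart differential is onto, and the components of its value at `d` are the `coordForm x j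
  -- d`.
  obtain ⟨d, hd⟩ := (isInvertible_mfderiv_extChartAt (I := 𝓘(ℝ, Fin (m + 1) → E))
    (mem_extChartAt_source x)).bijective.surjective u
  rw [← hd]
  refine Eq.trans ?_ (hP d)
  have h2 : momentumCovector L y x d = ∑ j : Fin (m + 1), momentum L y j (coordForm x j d) := by
    simp only [momentumCovector, sum_apply]
    rfl
  exact h2.symm

/-- For the top index the alternating sum reduces to its term `i = 0`, which involves no total
derivative. This is what makes the velocity terms cancel in the energy. -/
theorem momentum_last (L : HTangent E (m + 1) Q → ℝ) (y : HTangent E (2 * m + 1) Q) (v : E) :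
    momentum L y (Fin.last m) v =
      fderiv ℝ (localLagrangian L y.base) (fun a => coords y (Fin.castLE (by omega) a))
        (Pi.single (Fin.last (m + 1)) v) := by
  have hz : (fun a : Fin (m + 1 + 1) => iteratedDeriv a (polyCurve (coords y)) 0) =
      fun a => coords y (Fin.castLE (by omega) a) := by
    funext a
    exact iteratedDeriv_polyCurve (coords y) (Fin.castLE (by omega) a)
  simp only [momentum, ostrogradskyMomentum, Fin.val_last]
  rw [Finset.sum_eq_single ⟨0, by omega⟩]
  · simp only [pow_zero, one_smul, totalDeriv, iteratedDeriv_zero, hz, partialDeriv, add_zero]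
    rfl
  · intro i _ hi
    exact absurd (Fin.ext (by have := i.2; simp only; omega)) hi
  · simp

theorem localLagrangian_coords (L : HTangent E (m + 1) Q → ℝ) {r : ℕ} (hr : m + 1 ≤ r)
    (y : HTangent E r Q) {x : Q} (hx : y.base = x) :
    localLagrangian L x (fun a => natCoord r (chartAt E x) y (Fin.castLE (by omega) a)) =
      L (y.proj hr) := by
  subst hx
  have hs : y.base ∈ (chartAt E y.base).source := mem_chart_source E _
  rw [localLagrangian, ← natCoord_proj hr (chart_mem_atlas E _) y hs]
  congr 1
  exact (natChart (m + 1) (chartAt E y.base) (chart_mem_atlas E y.base)).left_inv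
    (by
      change (y.proj hr).base ∈ (chartAt E y.base).source
      rwa [base_proj])

theorem contDiffAt_localLagrangian {L : HTangent E (m + 1) Q → ℝ}
    (hL : ContMDiff 𝓘(ℝ, Fin (m + 1 + 1) → E) 𝓘(ℝ, ℝ) ∞ L) (x : Q) {z : Fin (m + 1 + 1) → E}
    (hz : z 0 ∈ (chartAt E x).target) : ContDiffAt ℝ ∞ (localLagrangian L x) z := by
  -- Any jet over `x` would do: the preferred chart depends only on the base point.
  set y : HTangent E (m + 1) Q := jetZero (m + 1) (fun _ => x) contMDiffAt_const with hy
  have h1 : ContMDiffAt 𝓘(ℝ, Fin (m + 1 + 1) → E) 𝓘(ℝ, Fin (m + 1 + 1) → E) ∞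
      (extChartAt 𝓘(ℝ, Fin (m + 1 + 1) → E) y).symm z :=
    (contMDiffOn_extChartAt_symm y).contMDiffAt
      ((isOpen_extChartAt_target y).mem_nhds (by rw [extChartAt_target]; exact ⟨hz, z, rfl⟩))
  exact ((hL _).comp z h1).contDiffAt

end Legendre

/-! ### The base velocity of the Hamiltonian vector field -/

section HamiltonianVelocity

variable {E : Type*} [NormedAddCommGroup E] [NormedSpace ℝ E]
  {Q : Type*} [TopologicalSpace Q] [ChartedSpace E Q] [IsManifold 𝓘(ℝ, E) ∞ Q] {m : ℕ}

theorem coords_eq {r : ℕ} (y : HTangent E r Q) {x : Q} (hx : y.base = x) :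
    coords y = natCoord r (chartAt E x) y := by
  subst hx
  rfl

/-- The projection to `T^{k-1} Q` of the Hamiltonian vector field at `FL(y)` has natural
coordinates `(q_1(y), …, q_k(y))`. -/
theorem mfderiv_cotangentProj_hamiltonianVectorField {L : HTangent E (m + 1) Q → ℝ}
    (hL : ContMDiff 𝓘(ℝ, Fin (m + 1 + 1) → E) 𝓘(ℝ, ℝ) ∞ L)
    (Φ : Diffeomorph 𝓘(ℝ, Fin (2 * m + 1 + 1) → E) (cotangentModel (Fin (m + 1) → E))
      (HTangent E (2 * m + 1) Q) (CotangentBundle (Fin (m + 1) → E) (HTangent E m Q)) ∞)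
    (hΦ : ∀ y, Φ y = legendreOstrogradsky L y)
    {h : CotangentBundle (Fin (m + 1) → E) (HTangent E m Q) → ℝ}
    (hh : IsAssociatedHamiltonian L h)
    {X : ∀ b : CotangentBundle (Fin (m + 1) → E) (HTangent E m Q),
      TangentSpace (cotangentModel (Fin (m + 1) → E)) b}
    (hX : IsHamiltonianVectorField h X)
    (b : CotangentBundle (Fin (m + 1) → E) (HTangent E m Q)) :
    mfderiv (cotangentModel (Fin (m + 1) → E)) 𝓘(ℝ, Fin (m + 1) → E)
        (cotangentProj (F := Fin (m + 1) → E) (M := HTangent E m Q)) b (X b) =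
      fun i : Fin (m + 1) => coords (Φ.symm b) ⟨i + 1, by omega⟩ := by
  refine hamiltonianVectorField_fst hX ((hh.1 b).mdifferentiableAt (by simp)) _ fun p => ?_
  set c := extChartAt (cotangentModel (Fin (m + 1) → E)) b with hc
  set z₀ : (Fin (m + 1) → E) × ((Fin (m + 1) → E) →L[ℝ] ℝ) := c b with hz₀
  -- A line along the fibre of T^*(T^{k-1}Q), in direction `p`; `y` below is its preimage under FL.
  set l : ℝ → (Fin (m + 1) → E) × ((Fin (m + 1) → E) →L[ℝ] ℝ) :=
    fun s => z₀ + s • ((0 : Fin (m + 1) → E), p) with hl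
  have hl1 : ∀ s, (l s).1 = z₀.1 := fun s => by simp [hl]
  have hl2 : ∀ s, (l s).2 = z₀.2 + s • p := fun s => by simp [hl]
  have hl0 : l 0 = z₀ := by simp [hl]
  set y : ℝ → HTangent E (2 * m + 1) Q := fun s => Φ.symm (c.symm (l s)) with hy
  have hFL : ∀ s, legendreOstrogradsky L (y s) = c.symm (l s) := fun s => by
    rw [← hΦ]
    exact Φ.apply_symm_apply _
  have hz₀1 : z₀.1 = extChartAt 𝓘(ℝ, Fin (m + 1) → E) b.proj b.proj := extChartAt_cotangent_fst b
  -- FL covers the projection, so `y` stays over the single point `b.proj`, and one natural chart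
  -- serves for all `s`.
  have hpr : ∀ s, (y s).proj (show m ≤ 2 * m + 1 by omega) = b.proj := fun s => by
    change (legendreOstrogradsky L (y s)).proj = b.proj
    rw [hFL, hc, proj_extChartAt_cotangent_symm, hl1, hz₀1]
    exact extChartAt_to_inv _
  have hbase : ∀ s, (y s).base = b.proj.base := fun s => by
    rw [← hpr s, base_proj]
  have hy0 : y 0 = Φ.symm b := by
    simp only [hy, hl0, hz₀]
    rw [extChartAt_to_inv]
  set e := chartAt E b.proj.base with he
  have hea : e ∈ atlas E Q := chart_mem_atlas E _
  have hys : ∀ s, (y s).base ∈ e.source := fun s => by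
    rw [hbase]
    exact mem_chart_source E _
  set z : ℝ → Fin (2 * m + 1 + 1) → E := fun s => natCoord (2 * m + 1) e (y s) with hz
  have hcoords : ∀ s, coords (y s) = z s := fun s => coords_eq _ (hbase s)
  -- the curve is differentiable in natural coordinates
  obtain ⟨z', hz'⟩ : ∃ z', HasDerivAt z z' 0 := by
    have hld : ContMDiffAt 𝓘(ℝ, ℝ) 𝓘(ℝ, (Fin (m + 1) → E) × ((Fin (m + 1) → E) →L[ℝ] ℝ)) ∞ l 0 :=
      ContDiffAt.contMDiffAt (by fun_prop)
    have h1 : ContMDiffAt 𝓘(ℝ, (Fin (m + 1) → E) × ((Fin (m + 1) → E) →L[ℝ] ℝ))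
        (cotangentModel (Fin (m + 1) → E)) ∞ c.symm (l 0) := by
      rw [hl0]
      exact (contMDiffOn_extChartAt_symm b).contMDiffAt (extChartAt_target_mem_nhds b)
    have h2 : ContMDiffAt 𝓘(ℝ, ℝ) 𝓘(ℝ, Fin (2 * m + 1 + 1) → E) ∞ y 0 :=
      (Φ.symm.contMDiff _).comp (0 : ℝ) (h1.comp (0 : ℝ) hld)
    have h3 : ContMDiffAt 𝓘(ℝ, Fin (2 * m + 1 + 1) → E) 𝓘(ℝ, Fin (2 * m + 1 + 1) → E) ∞
        (natCoord (2 * m + 1) (chartAt E (y 0).base)) (y 0) :=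
      contMDiffAt_extChartAt (I := 𝓘(ℝ, Fin (2 * m + 1 + 1) → E)) (x := y 0)
    rw [hbase] at h3
    exact ⟨_, ((h3.comp (0 : ℝ) h2).contDiffAt.differentiableAt (by simp)).hasDerivAt⟩
  -- The coordinates q_0, …, q_{k-1} of `y` are those of `b.proj`, hence constant.
  have hz'0 : ∀ i : Fin (2 * m + 1 + 1), (i : ℕ) ≤ m → z' i = 0 := by
    intro i hi
    have hconst : (fun s => z s i) = fun _ => natCoord m e b.proj ⟨i, by omega⟩ := by
      funext s
      rw [← hpr s, natCoord_proj _ hea _ (hys s)]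
      rfl
    have h1 := hasDerivAt_pi.1 hz' i
    rw [hconst] at h1
    exact h1.unique (hasDerivAt_const _ _)
  -- `S` extracts (q_1, …, q_k), paired with the momenta; `T` extracts (q_0, …, q_k), the arguments
  -- of the Lagrangian. Among the moving coordinates both see only q_k, in the last slot.
  set S : (Fin (2 * m + 1 + 1) → E) →L[ℝ] Fin (m + 1) → E :=
    ContinuousLinearMap.pi fun i => ContinuousLinearMap.proj ⟨i + 1, by omega⟩ with hS
  set T : (Fin (2 * m + 1 + 1) → E) →L[ℝ] Fin (m + 1 + 1) → E :=
    ContinuousLinearMap.pi fun i => ContinuousLinearMap.proj (Fin.castLE (by omega) i) with hT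
  have hmom : ∀ s (u : Fin (m + 1) → E),
      ∑ j : Fin (m + 1), momentum L (y s) j (u j) = (z₀.2 + s • p) u := by
    intro s u
    rw [← hl2]
    refine sum_momentum_apply L (y s) (hpr s).symm _ (fun d => ?_) u
    refine snd_extChartAt_cotangent_symm b ?_ _ (hFL s) d
    rw [hl1, hz₀1]
    exact mem_extChartAt_target _
  set ℓ := localLagrangian L b.proj.base with hℓ
  have hcurve : (fun s => h (c.symm (l s))) = fun s => (z₀.2 + s • p) (S (z s)) - ℓ (T (z s)) := by
    funext s
    rw [← hFL, hh.2, lagrangianEnergy, ← hmom,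
      ← localLagrangian_coords L (show m + 1 ≤ 2 * m + 1 by omega) (y s) (hbase s), hcoords]
    rfl
  have hT0 : T (z 0) 0 = e b.proj.base := by
    rw [← hbase 0]
    exact natCoord_zero e hea (y 0) (hys 0)
  have hℓd : HasFDerivAt ℓ (fderiv ℝ ℓ (T (z 0))) (T (z 0)) :=
    ((contDiffAt_localLagrangian hL b.proj.base (by
      rw [hT0]
      exact e.map_source (mem_chart_source E _))).differentiableAt (by simp)).hasFDerivAt
  have hp : HasDerivAt (fun s : ℝ => z₀.2 + s • p) p 0 := by
    simpa using ((hasDerivAt_id (0 : ℝ)).smul_const p).const_add z₀.2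
  have hd1 := hp.clm_apply (S.hasFDerivAt.comp_hasDerivAt 0 hz')
  have hd2 := hℓd.comp_hasDerivAt 0 (T.hasFDerivAt.comp_hasDerivAt 0 hz')
  have hd := hd1.sub hd2
  -- the velocity contributions cancel, since the last momentum is `∂L/∂q_k`
  have hcancel : (z₀.2 + (0 : ℝ) • p) (S z') = fderiv ℝ ℓ (T (z 0)) (T z') := by
    rw [← hmom, Finset.sum_eq_single (Fin.last m)]
    · rw [momentum_last, hcoords, hbase]
      change fderiv ℝ ℓ (T (z 0)) _ = _
      congr 1
      funext i
      refine Fin.lastCases ?_ (fun i => ?_) i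
      · rw [Pi.single_eq_same]
        rfl
      · rw [Pi.single_eq_of_ne (Fin.castSucc_lt_last i).ne]
        exact (hz'0 _ (Nat.lt_succ_iff.1 i.2)).symm
    · intro j _ hj
      have hjm : (j : ℕ) < m := lt_of_le_of_ne (Nat.lt_succ_iff.1 j.2) fun h => hj (Fin.ext h)
      have : S z' j = 0 := hz'0 ⟨j + 1, by omega⟩ hjm
      rw [this, map_zero]
    · simp
  rw [hcancel, add_sub_cancel_right] at hd
  rw [hcurve, ← hy0, hcoords]
  exact hd

end HamiltonianVelocity

/-! ### From the components of a vector field to holonomic integral curves -/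

section Holonomy

variable {E : Type*} [NormedAddCommGroup E] [NormedSpace ℝ E] {r : ℕ}
  {Q : Type*} [TopologicalSpace Q] [ChartedSpace E Q] [IsManifold 𝓘(ℝ, E) ∞ Q]

/-- The function here is the right-hand side of the equation that integral curves satisfy in the
chart at `x₀`. It is the fibre component of the section `X` in the trivialization of the tangent
bundle at `x₀`. -/
theorem contDiffOn_tangentCoordChange {F M : Type*} [NormedAddCommGroup F] [NormedSpace ℝ F]
    [TopologicalSpace M] [ChartedSpace F M] [IsManifold 𝓘(ℝ, F) ∞ M]
    {X : ∀ x : M, TangentSpace 𝓘(ℝ, F) x}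
    (hX : ContMDiff 𝓘(ℝ, F) 𝓘(ℝ, F).tangent ∞ (fun x => (⟨x, X x⟩ : TangentBundle 𝓘(ℝ, F) M)))
    (x₀ : M) :
    ContDiffOn ℝ ∞ (fun z : F => tangentCoordChange 𝓘(ℝ, F) ((extChartAt 𝓘(ℝ, F) x₀).symm z) x₀
      ((extChartAt 𝓘(ℝ, F) x₀).symm z) (X ((extChartAt 𝓘(ℝ, F) x₀).symm z)))
      (extChartAt 𝓘(ℝ, F) x₀).target := by
  have h1 := ((trivializationAt F (TangentSpace 𝓘(ℝ, F)) x₀).contMDiffOn_section_baseSet_iff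
    (IB := 𝓘(ℝ, F)) (n := ∞) (s := X)).1 hX.contMDiffOn
  have h2 := h1.comp (contMDiffOn_extChartAt_symm (n := ∞) (I := 𝓘(ℝ, F)) x₀) (fun z hz => by
    have := (extChartAt 𝓘(ℝ, F) x₀).map_target hz
    rwa [extChartAt_source] at this)
  exact h2.contDiffOn

/-- A curve whose natural coordinates satisfy `q_i' = q_{i+1}`, `i < r`, is holonomic. -/
theorem isHolonomicOn_of_hasDerivAt {e : OpenPartialHomeomorph Q E} (he : e ∈ atlas E Q)
    {ψ : ℝ → HTangent E r Q} {U : Set ℝ} (hU : IsOpen U)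
    (hψ : ∀ t ∈ U, (ψ t).base ∈ e.source)
    (hsm : ContDiffOn ℝ ∞ (fun t => natCoord r e (ψ t)) U)
    (hd : ∀ t ∈ U, ∀ i : Fin r, HasDerivAt (fun s => natCoord r e (ψ s) i.castSucc)
      (natCoord r e (ψ t) i.succ) t) : IsHolonomicOn ψ U := by
  intro t ht
  have hbase : ∀ s ∈ U, e (ψ s).base = natCoord r e (ψ s) 0 := fun s hs =>
    (natCoord_zero e he _ (hψ s hs)).symm
  have hUt : U ∈ 𝓝 t := hU.mem_nhds ht
  -- Iterating q_i' = q_{i+1} makes q_k the k-th derivative of q_0.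
  have hder : ∀ k (hk : k < r + 1), ∀ s ∈ U,
      iteratedDeriv k (fun s => natCoord r e (ψ s) 0) s = natCoord r e (ψ s) ⟨k, hk⟩ := by
    intro k
    induction k with
    | zero => intro hk s _; simp
    | succ k ih =>
      intro hk s hs
      have hev : iteratedDeriv k (fun s => natCoord r e (ψ s) 0) =ᶠ[𝓝 s]
          fun s => natCoord r e (ψ s) ⟨k, by omega⟩ := by
        filter_upwards [hU.mem_nhds hs] with s' hs' using ih _ s' hs'
      rw [iteratedDeriv_succ, hev.deriv_eq]
      exact (hd s hs ⟨k, by omega⟩).deriv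
  have hz0 : ContDiffAt ℝ ∞ (fun s => natCoord r e (ψ s) 0) t :=
    contDiffAt_pi.1 (hsm.contDiffAt hUt) 0
  have hφ : ContMDiffAt 𝓘(ℝ, ℝ) 𝓘(ℝ, E) ∞ (fun s => (ψ s).base) t := by
    refine (contMDiffAt_symm_comp he hz0 ?_).congr_of_eventuallyEq ?_
    · rw [← hbase t ht]
      exact e.map_source (hψ t ht)
    · filter_upwards [hUt] with s hs
      rw [Function.comp_apply, ← hbase s hs, e.left_inv (hψ s hs)]
  refine ⟨hφ, ?_⟩
  have hb : (fun s => (ψ (t + s)).base) 0 ∈ e.source := by simpa using hψ t ht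
  -- Two jets in the domain of a natural chart are equal once their coordinates are.
  refine (natChart r e he).injOn (hψ t ht) hb ?_
  change natCoord r e (ψ t) = natCoord r e (jetZero r _ (contMDiffAt_shift hφ))
  rw [natCoord_jetZero r he _ _ hb]
  funext i
  rw [← hder i i.2 t ht]
  have h1 : iteratedDeriv i (fun s => e (ψ (t + s)).base) 0 =
      iteratedDeriv i (fun s => e (ψ s).base) t := by
    simpa using congrFun (iteratedDeriv_comp_const_add (i : ℕ) (fun s => e (ψ s).base) t) 0
  have h2 : (fun s => e (ψ s).base) =ᶠ[𝓝 t] fun s => natCoord r e (ψ s) 0 := by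
    filter_upwards [hUt] with s hs using hbase s hs
  exact (h1.trans (h2.iteratedDeriv_eq _)).symm

/-- A smooth vector field on `T^r Q` with natural components `(q_1, …, q_r, *)` is a semispray of
type `1`. -/
theorem isSemispray_of_castSucc {X : ∀ y : HTangent E r Q, TangentSpace 𝓘(ℝ, Fin (r + 1) → E) y}
    (hX : ContMDiff 𝓘(ℝ, Fin (r + 1) → E) 𝓘(ℝ, Fin (r + 1) → E).tangent ∞
      (fun y => (⟨y, X y⟩ : TangentBundle 𝓘(ℝ, Fin (r + 1) → E) (HTangent E r Q))))
    (hc : ∀ y (i : Fin r), (show Fin (r + 1) → E from X y) i.castSucc = coords y i.succ) :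
    IsSemispray X := by
  intro J ψ hJ _ hψ t₀ ht₀
  have hat := hψ.isMIntegralCurveAt (hJ.mem_nhds ht₀)
  set c := extChartAt 𝓘(ℝ, Fin (r + 1) → E) (ψ t₀) with hcdef
  have hsrc : ∀ᶠ t in 𝓝 t₀, ψ t ∈ c.source :=
    hat.continuousAt.preimage_mem_nhds (extChartAt_source_mem_nhds (ψ t₀))
  -- Near `t₀` the curve stays in the chart at `ψ t₀` and solves there the equation whose right-hand
  -- side is `X` transported from the chart at `ψ t`.
  obtain ⟨U, hU, hUo, htU⟩ := eventually_nhds_iff.1 (hsrc.and hat.eventually_hasDerivAt)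
  have hbase : ∀ t ∈ U, (ψ t).base ∈ (chartAt E (ψ t₀).base).source := fun t ht => by
    have := (hU t ht).1
    rw [hcdef, extChartAt_source] at this
    exact this
  have hsm : ContDiffOn ℝ ∞ (c ∘ ψ) U := by
    refine contDiffOn_of_hasDerivAt_comp hUo (contDiffOn_tangentCoordChange hX (ψ t₀))
      (fun t ht => c.map_source (hU t ht).1) fun t ht => ?_
    have hinv : c.symm ((c ∘ ψ) t) = ψ t := c.left_inv (hU t ht).1
    rw [hinv]
    exact (hU t ht).2
  refine isHolonomicOn_of_hasDerivAt (chart_mem_atlas E (ψ t₀).base) hUo hbase hsm ?_ t₀ htU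
  intro t ht i
  have h1 := hasDerivAt_pi.1 (hU t ht).2 i.castSucc
  rw [tangentCoordChange_castSucc (hbase t ht) (hc (ψ t))] at h1
  exact h1

end Holonomy

/-! ### The vector field of a Hamilton–Jacobi solution -/

theorem contMDiff_associatedVectorField {F M : Type*} [NormedAddCommGroup F] [NormedSpace ℝ F]
    [TopologicalSpace M] [ChartedSpace F M] [IsManifold 𝓘(ℝ, F) ∞ M]
    {X : ∀ b : CotangentBundle F M, TangentSpace (cotangentModel F) b}
    (hX : ContMDiff (cotangentModel F) (cotangentModel F).tangent ∞
      (fun b => (⟨b, X b⟩ : TangentBundle (cotangentModel F) (CotangentBundle F M))))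
    {α : ∀ x : M, TangentSpace 𝓘(ℝ, F) x →L[ℝ] ℝ} (hα : IsSmoothOneForm α) :
    ContMDiff 𝓘(ℝ, F) 𝓘(ℝ, F).tangent ∞
      (fun x => (⟨x, associatedVectorField X α x⟩ : TangentBundle 𝓘(ℝ, F) M)) := by
  have hπ : ContMDiff (cotangentModel F) 𝓘(ℝ, F) ∞ (cotangentProj (F := F) (M := M)) :=
    Bundle.contMDiff_proj (fun x : M => TangentSpace 𝓘(ℝ, F) x →L[ℝ] Bundle.Trivial M ℝ x)
  exact (hπ.contMDiff_tangentMap (m := ∞) (by simp)).comp (hX.comp hα)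

end HigherOrder

theorem mainTheorem7 {n m : ℕ} {Q : Type*} [TopologicalSpace Q] [T2Space Q]
    [SecondCountableTopology Q] [ChartedSpace (EuclideanSpace ℝ (Fin n)) Q]
    [IsManifold (𝓡 n) ∞ Q]
    -- a hyperregular Lagrangian of order `k = m + 1` on `T^k Q`
    (L : HTangent (EuclideanSpace ℝ (Fin n)) (m + 1) Q → ℝ)
    (hL : ContMDiff 𝓘(ℝ, Fin (m + 1 + 1) → EuclideanSpace ℝ (Fin n)) 𝓘(ℝ, ℝ) ∞ L)
    (hreg : IsHyperregular L)
    -- the associated Hamiltonian system on `T^*(T^{k-1} Q)`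
    (h : CotangentBundle (Fin (m + 1) → EuclideanSpace ℝ (Fin n))
      (HTangent (EuclideanSpace ℝ (Fin n)) m Q) → ℝ)
    (hh : IsAssociatedHamiltonian L h)
    (Xh : ∀ b : CotangentBundle (Fin (m + 1) → EuclideanSpace ℝ (Fin n))
        (HTangent (EuclideanSpace ℝ (Fin n)) m Q),
      TangentSpace (cotangentModel (Fin (m + 1) → EuclideanSpace ℝ (Fin n))) b)
    (hXh : IsHamiltonianVectorField h Xh)
    -- a solution of the `k`-th order Hamiltonian Hamilton-Jacobi problem
    (α : ∀ x : HTangent (EuclideanSpace ℝ (Fin n)) m Q,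
      TangentSpace 𝓘(ℝ, Fin (m + 1) → EuclideanSpace ℝ (Fin n)) x →L[ℝ] ℝ)
    (hα : IsHJSolution Xh α) :
    IsSemispray (associatedVectorField Xh α) := by
  obtain ⟨Φ, hΦ⟩ := hreg
  refine isSemispray_of_castSucc (contMDiff_associatedVectorField hXh.1 hα.2.1) fun x i => ?_
  -- FL covers the projection, and the covector α(x) sits over `x`.
  have hproj : (Φ.symm (formSection α x)).proj (show m ≤ 2 * m + 1 by omega) = x := by
    change (legendreOstrogradsky L (Φ.symm (formSection α x))).proj = x
    rw [← hΦ, Φ.apply_symm_apply]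
    rfl
  set y := Φ.symm (formSection α x) with hy
  have hbase : y.base = x.base := by rw [← hproj, base_proj]
  have hs : y.base ∈ (chartAt (EuclideanSpace ℝ (Fin n)) x.base).source := by
    rw [hbase]
    exact mem_chart_source _ _
  have h1 := congrFun (mfderiv_cotangentProj_hamiltonianVectorField hL Φ hΦ hh hXh
    (formSection α x)) i.castSucc
  refine h1.trans ?_
  -- Since `i < m`, the index `i + 1` is at most `m = k - 1`, so q_{i+1} survives the projection to
  -- T^{k-1}Q.
  rw [← hy, coords_eq y hbase, coords_eq x rfl, ← hproj, base_proj,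
    natCoord_proj _ (chart_mem_atlas _ _) y (by rw [hbase] at hs ⊢; exact hs)]
  rfl
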